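/- Let $0<b<1$ and let $a>0$ be determined by $\tanh(2a)=3b/(2+b^2)$. Let $V(\phi)=2\phi^2(\phi-\tanh a)(\phi-\coth a)$. For collective coordinates $A(t),B(t),C(t)>0$ put $$\phi(x,t)=\tfrac12A(t)\bigl(\tanh(B(t)x+C(t))-\tanh(B(t)x-C(t))\bigr),$$ and let $S[A,B,C]=\int\int_{\mathbb R}\bigl(-\tfrac12\phi_t^2+\tfrac12\phi_x^2+V(\phi)\bigr)\,dx\,dt$ be the effective action obtained by integrating the Klein–Gordon action density of this ansatz over $x$. Then for all real parameters $B_0$ and $T$ the Euler–Lagrange equations $\delta S/\delta A=\delta S/\delta B=\delta S/\delta C=0$ have a lump solution $$\phi(x,t)=\tfrac12A\bigl(\tanh(B(x+X))-\tanh(B(x-X))\bigr),\qquad C=BX,$$ in the sense of formal asymptotic series in $1/(t+T)$ as $t\to\infty$, whose coefficients depend only on $b$ and $B_0$: $$X= (t+T)+\frac{b^2}{8(1-b^2)^2}\Bigl((t+T)^{-1}-\frac{b^2B_0}{2(1-b^2)}(t+T)^{-2}+\Bigl(\frac{b^4B_0^2}{4(1-b^2)^2}+\frac{\pi^2b^2}{12}+\frac{b^2(12b^6-44b^4+53b^2-22)}{16(2-b^2)(1-b^2)^2}\Bigr)(t+T)^{-3}+\cdots\Bigr),$$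 $$B=\frac{2(1-b^2)}{b^2}(t+T)+B_0+\frac{b^2}{4(1-b^2)}\Bigl(\frac{3-2b^2}{2-b^2}(t+T)^{-1}-\frac{B_0}{2(1-b^2)}(t+T)^{-2}+\Bigl(\frac{b^2B_0^2}{4(1-b^2)^2}+\frac{\pi^2(22-13b^2)}{36(2-b^2)}+\frac{80b^{10}-686b^8+2213b^6-3368b^4+2450b^2-692}{48(1-b^2)^2(2-b^2)^3}\Bigr)(t+T)^{-3}+\cdots\Bigr),$$ $$A=\frac1b+\frac{b}{8(2-b^2)}\Bigl((t+T)^{-2}-\frac{b^2B_0}{2(1-b^2)}(t+T)^{-3}+\Bigl(\frac{b^4B_0^2}{4(1-b^2)^2}-\frac{\pi^2b^2}{18(1-b^2)}-\frac{b^2(17b^6-91b^4+148b^2-62)}{24(1-b^2)^2(2-b^2)^2}\Bigr)(t+T)^{-4}+\cdots\Bigr).$$ Precisely, the series continue to all orders, and for every $N\ge 0$, if $X$ and $B$ are truncated after the term of order $(t+T)^{-N}$ and $A$ after the term of order $(t+T)^{-(N+1)}$, then the left-hand sides of the three Euler–Lagrange equations are $O(t^{-(N+1)})$ as $t\to\infty$.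 The conserved energy of the solution is $E=\tfrac23B_0/b^2$: for the same truncations, $\int_{\mathbb R}\bigl(\tfrac12\phi_t^2+\tfrac12\phi_x^2+V(\phi)\bigr)dx=\tfrac23B_0/b^2+O(t^{-(N+1)})$ for every $N\ge0$. No convergence of the series is claimed. -/

import Mathlib

open Filter Asymptotics MeasureTheory

noncomputable section

namespace Sphaleron

/-- The quartic potential with a false vacuum at `0`:
`V(φ) = 2 φ² (φ - tanh a) (φ - coth a)`. -/
def potential (a φ : ℝ) : ℝ :=
  2 * φ ^ 2 * (φ - Real.tanh a) * (φ - (Real.tanh a)⁻¹)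

/-- The Klein-Gordon energy at time `t` of a field `φ x t`. -/
def fieldEnergy (a : ℝ) (φ : ℝ → ℝ → ℝ) (t : ℝ) : ℝ :=
  ∫ x : ℝ, (1 / 2 * (deriv (fun s => φ x s) t) ^ 2
    + 1 / 2 * (deriv (fun y => φ y t) x) ^ 2 + potential a (φ x t))

/-- The kink-antikink profile with collective coordinates `A`, `B`, `C`. -/
def profile (A B C x : ℝ) : ℝ :=
  A / 2 * (Real.tanh (B * x + C) - Real.tanh (B * x - C))

/-- The time derivative of the profile when the collective coordinates are at `(A, B, C)` and
move with velocity `(A', B', C')`. -/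
def profileVelocity (A B C A' B' C' x : ℝ) : ℝ :=
  deriv (fun s => profile (A + s * A') (B + s * B') (C + s * C') x) 0

/-- The effective Lagrangian: the Klein-Gordon action density
`-φ_t² / 2 + φ_x² / 2 + V(φ)` of the profile, integrated over space. -/
def effLagrangian (a A B C A' B' C' : ℝ) : ℝ :=
  ∫ x : ℝ, (-(1 / 2) * (profileVelocity A B C A' B' C' x) ^ 2
    + 1 / 2 * (deriv (profile A B C) x) ^ 2 + potential a (profile A B C x))

/-- The variational derivative `δS/δA = ∂L/∂A - d/dt (∂L/∂A')` of the effective action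
`S[A, B, C] = ∫ L(A, B, C, A', B', C') dt` along the curve `(A, B, C)`. -/
def variationA (a : ℝ) (A B C : ℝ → ℝ) (t : ℝ) : ℝ :=
  deriv (fun y => effLagrangian a y (B t) (C t) (deriv A t) (deriv B t) (deriv C t)) (A t)
  - deriv (fun s =>
      deriv (fun y => effLagrangian a (A s) (B s) (C s) y (deriv B s) (deriv C s)) (deriv A s)) t

/-- The variational derivative `δS/δB` of the effective action. -/
def variationB (a : ℝ) (A B C : ℝ → ℝ) (t : ℝ) : ℝ :=
  deriv (fun y => effLagrangian a (A t) y (C t) (deriv A t) (deriv B t) (deriv C t)) (B t)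
  - deriv (fun s =>
      deriv (fun y => effLagrangian a (A s) (B s) (C s) (deriv A s) y (deriv C s)) (deriv B s)) t

/-- The variational derivative `δS/δC` of the effective action. -/
def variationC (a : ℝ) (A B C : ℝ → ℝ) (t : ℝ) : ℝ :=
  deriv (fun y => effLagrangian a (A t) (B t) y (deriv A t) (deriv B t) (deriv C t)) (C t)
  - deriv (fun s =>
      deriv (fun y => effLagrangian a (A s) (B s) (C s) (deriv A s) (deriv B s) y) (deriv C s)) t

/-- The lump with height `A`, flank steepness `B` and flanks located at `±X`. -/
def lump (A B X : ℝ → ℝ) (x t : ℝ) : ℝ :=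
  1 / 2 * A t * (Real.tanh (B t * (x + X t)) - Real.tanh (B t * (x - X t)))

/-- Partial sum of the series `X = (t + T) + ξ₁ (t + T)⁻¹ + ξ₂ (t + T)⁻² + ⋯`. -/
def seriesX (T : ℝ) (ξ : ℕ → ℝ) (N : ℕ) (t : ℝ) : ℝ :=
  (t + T) + ∑ n ∈ Finset.Icc 1 N, ξ n / (t + T) ^ n

/-- Partial sum of the series
`B = (2 (1 - b²) / b²) (t + T) + B₀ + β₁ (t + T)⁻¹ + β₂ (t + T)⁻² + ⋯`. -/
def seriesB (b T B₀ : ℝ) (β : ℕ → ℝ) (N : ℕ) (t : ℝ) : ℝ :=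
  2 * (1 - b ^ 2) / b ^ 2 * (t + T) + B₀ + ∑ n ∈ Finset.Icc 1 N, β n / (t + T) ^ n

/-- Partial sum of the series `A = 1 / b + α₂ (t + T)⁻² + α₃ (t + T)⁻³ + ⋯`. -/
def seriesA (b T : ℝ) (α : ℕ → ℝ) (N : ℕ) (t : ℝ) : ℝ :=
  1 / b + ∑ n ∈ Finset.Icc 2 N, α n / (t + T) ^ n

/-- `(A, B, X)`, given by their partial sums, are a formal (asymptotic) series solution of the
Euler-Lagrange equations of the effective action, with `C = B X`: the partial sums up to order
`N` (and `N + 1` for `A`) satisfy the three equations up to an error `O(t ^ (-(N + 1)))`,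
for every `N`. -/
def IsSeriesSolution (a : ℝ) (A B X : ℕ → ℝ → ℝ) : Prop :=
  ∀ N : ℕ,
    (variationA a (A (N + 1)) (B N) (fun t => B N t * X N t)
      =O[atTop] fun t : ℝ => (t ^ (N + 1))⁻¹) ∧
    (variationB a (A (N + 1)) (B N) (fun t => B N t * X N t)
      =O[atTop] fun t : ℝ => (t ^ (N + 1))⁻¹) ∧
    (variationC a (A (N + 1)) (B N) (fun t => B N t * X N t)
      =O[atTop] fun t : ℝ => (t ^ (N + 1))⁻¹)

end Sphaleron

end

/-!
Put `X = C / B`. Once the overlap integrals of the two `tanh` steps are evaluated in closed form,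
the Euler-Lagrange expressions become rational in `B`, `C`, `coth (2 C)` and polynomial in the
remaining jets. Along the lump `C = B X` grows quadratically, so `coth (2 C) - 1` is exponentially
small and may be dropped.

Inserting `X = z⁻¹ (1 + z² x)`, `B = z⁻¹ (2 (b⁻² - 1) + z B₀ + z² y)`, `A = b⁻¹ + z² a` with power
series `x`, `y`, `a` in `z = 1 / (t + T)`, the `n`th coefficients of the equations `δS/δB`, `δS/δA`,
`δS/δX` determine the `n`th coefficients of `x`, `a`, `y` in this order from the earlier ones. A
truncation agrees with the formal solution modulo a power of `z`, and so do the polynomial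
equations, whence the error estimates.

The energy `E` satisfies `E' = A' δS/δA + B' δS/δB + X' δS/δX`, which is `O(t⁻ᴺ⁻²)` on a truncation;
integrating from infinity, where `E` tends to `(2 / 3) B₀ / b²`, gives the energy estimate.
-/

noncomputable section

namespace Sphaleron

/-! ### Integrals with a known value -/

section HasIntegral

variable {α : Type*} [MeasurableSpace α] {μ : Measure α}

/-- `f` is integrable with integral `v`; unlike `∫ x, f x ∂μ = v`, this is meaningful for
`v = 0`. -/
def HasIntegral (f : α → ℝ) (v : ℝ) (μ : Measure α := by volume_tac) : Prop :=
  Integrable f μ ∧ ∫ x, f x ∂μ = v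

variable {f g : α → ℝ} {v w : ℝ}

theorem HasIntegral.add (hf : HasIntegral f v μ) (hg : HasIntegral g w μ) :
    HasIntegral (fun x => f x + g x) (v + w) μ :=
  ⟨hf.1.add hg.1, by rw [integral_add hf.1 hg.1, hf.2, hg.2]⟩

theorem HasIntegral.sub (hf : HasIntegral f v μ) (hg : HasIntegral g w μ) :
    HasIntegral (fun x => f x - g x) (v - w) μ :=
  ⟨hf.1.sub hg.1, by rw [integral_sub hf.1 hg.1, hf.2, hg.2]⟩

theorem HasIntegral.const_mul (c : ℝ) (hf : HasIntegral f v μ) :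
    HasIntegral (fun x => c * f x) (c * v) μ :=
  ⟨hf.1.const_mul c, by rw [integral_const_mul, hf.2]⟩

theorem HasIntegral.congr (hf : HasIntegral f v μ) (hfg : ∀ x, g x = f x) (hwv : w = v) :
    HasIntegral g w μ := by
  rwa [funext hfg, hwv]

end HasIntegral

section Line

variable {f g F : ℝ → ℝ} {c v m₀ m₁ m₂ m₃ : ℝ}

theorem HasIntegral.comp_add (c : ℝ) (hf : HasIntegral f v) : HasIntegral (fun x => f (x + c)) v :=
  ⟨hf.1.comp_add_right c, by rw [integral_add_right_eq_self, hf.2]⟩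

theorem HasIntegral.comp_mul (hc : 0 < c) (hf : HasIntegral f v) :
    HasIntegral (fun x => f (c * x)) (v / c) :=
  ⟨hf.1.comp_mul_left' hc.ne', by
    rw [Measure.integral_comp_mul_left, hf.2, abs_of_pos (inv_pos.2 hc), smul_eq_mul]; ring⟩

theorem hasIntegral_zero_of_odd (hf : Integrable f) (hodd : f.Odd) : HasIntegral f 0 :=
  ⟨hf, self_eq_neg.1 <| by
    rw [← integral_neg, ← integral_neg_eq_self f]
    exact integral_congr_ae (.of_forall hodd)⟩

theorem HasIntegral.mul_comp_add (c : ℝ) (h₀ : HasIntegral f m₀)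
    (h₁ : HasIntegral (fun x => x * f x) m₁) :
    HasIntegral (fun y => y * f (y + c)) (m₁ - c * m₀) :=
  ((h₁.comp_add c).sub ((h₀.comp_add c).const_mul c)).congr (fun y => by ring) rfl

theorem HasIntegral.sq_mul_comp_add (c : ℝ) (h₀ : HasIntegral f m₀)
    (h₁ : HasIntegral (fun x => x * f x) m₁) (h₂ : HasIntegral (fun x => x ^ 2 * f x) m₂) :
    HasIntegral (fun y => y ^ 2 * f (y + c)) (m₂ - 2 * c * m₁ + c ^ 2 * m₀) :=
  (((h₂.comp_add c).sub ((h₁.comp_add c).const_mul (2 * c))).add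
    ((h₀.comp_add c).const_mul (c ^ 2))).congr (fun y => by ring) rfl

theorem HasIntegral.cube_mul_comp_add (c : ℝ) (h₀ : HasIntegral f m₀)
    (h₁ : HasIntegral (fun x => x * f x) m₁) (h₂ : HasIntegral (fun x => x ^ 2 * f x) m₂)
    (h₃ : HasIntegral (fun x => x ^ 3 * f x) m₃) :
    HasIntegral (fun y => y ^ 3 * f (y + c))
      (m₃ - 3 * c * m₂ + 3 * c ^ 2 * m₁ - c ^ 3 * m₀) :=
  ((((h₃.comp_add c).sub ((h₂.comp_add c).const_mul (3 * c))).add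
    ((h₁.comp_add c).const_mul (3 * c ^ 2))).sub ((h₀.comp_add c).const_mul (c ^ 3))).congr
    (fun y => by ring) rfl

theorem HasIntegral.of_hasDerivAt (hF : ∀ x, HasDerivAt F (c * f x + g x) x) (hFi : Integrable F)
    (hfi : Integrable f) (hg : HasIntegral g (-(c * v))) (hc : c ≠ 0) : HasIntegral f v := by
  have htotal : ∫ x, (c * f x + g x) = 0 :=
    integral_eq_zero_of_hasDerivAt_of_integrable hF ((hfi.const_mul c).add hg.1) hFi
  rw [integral_add (hfi.const_mul c) hg.1, integral_const_mul, hg.2, add_neg_eq_zero] at htotal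
  exact ⟨hfi, mul_left_cancel₀ hc htotal⟩

end Line

/-! ### Moments of `sech²` -/

open Real in
theorem one_sub_tanh_eq (u : ℝ) : 1 - tanh u = 2 * exp (-(2 * u)) / (1 + exp (-(2 * u))) := by
  have hexp : exp (-(2 * u)) = exp (-u) * exp (-u) := by rw [← exp_add]; ring_nf
  have hmul : exp u * exp (-u) = 1 := by rw [← exp_add]; simp
  rw [tanh_eq, hexp]
  field_simp
  linear_combination (-2 * exp (-u)) * hmul

/-- The function `sech² = tanh'`. -/
def sechSq (u : ℝ) : ℝ := 1 - Real.tanh u ^ 2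

theorem sechSq_eq (u : ℝ) : sechSq u = 1 / Real.cosh u ^ 2 := by
  rw [sechSq, Real.tanh_eq_sinh_div_cosh]
  field_simp
  linarith [Real.cosh_sq u]

theorem sechSq_pos (u : ℝ) : 0 < sechSq u :=
  sub_pos.2 (Real.tanh_sq_lt_one u)

theorem abs_tanh_le_one (u : ℝ) : |Real.tanh u| ≤ 1 := (Real.abs_tanh_lt_one u).le

theorem abs_sechSq_le_one (u : ℝ) : |sechSq u| ≤ 1 := by
  rw [abs_of_pos (sechSq_pos u)]
  exact sub_le_self 1 (sq_nonneg _)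

theorem even_sechSq : sechSq.Even := fun u => by rw [sechSq, sechSq, Real.tanh_neg, neg_sq]

theorem hasDerivAt_tanh (u : ℝ) : HasDerivAt Real.tanh (sechSq u) u := by
  rw [funext Real.tanh_eq_sinh_div_cosh]
  refine ((Real.hasDerivAt_sinh u).div (Real.hasDerivAt_cosh u)
    (Real.cosh_pos u).ne').congr_deriv ?_
  rw [sechSq_eq, ← Real.cosh_sq_sub_sinh_sq u]
  ring

theorem hasDerivAt_sechSq (u : ℝ) : HasDerivAt sechSq (-2 * (Real.tanh u * sechSq u)) u :=
  (((hasDerivAt_tanh u).fun_pow 2).const_sub 1).congr_deriv (by push_cast; ring)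

@[fun_prop]
theorem continuous_tanh : Continuous Real.tanh :=
  continuous_iff_continuousAt.2 fun u => (hasDerivAt_tanh u).continuousAt

@[fun_prop]
theorem continuous_sechSq : Continuous sechSq :=
  continuous_iff_continuousAt.2 fun u => (hasDerivAt_sechSq u).continuousAt

theorem tendsto_tanh_atTop : Tendsto Real.tanh atTop (nhds 1) := by
  have hexp : Tendsto (fun u : ℝ => Real.exp (-(2 * u))) atTop (nhds 0) :=
    Real.tendsto_exp_neg_atTop_nhds_zero.comp (tendsto_id.const_mul_atTop two_pos)
  have hquot := ((hexp.const_mul 2).div (hexp.const_add 1) (by norm_num)).const_sub 1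
  refine (hquot.congr fun u => ?_).trans (by norm_num)
  simp only [Pi.div_apply, ← one_sub_tanh_eq]
  ring

theorem tendsto_tanh_atBot : Tendsto Real.tanh atBot (nhds (-1)) :=
  (tendsto_tanh_atTop.comp tendsto_neg_atBot_atTop).neg.congr fun u => by simp [Real.tanh_neg]

theorem sechSq_le_exp (u : ℝ) : sechSq u ≤ 4 * Real.exp (-(2 * |u|)) := by
  have hcosh : Real.exp |u| / 2 ≤ Real.cosh u := by
    rw [← Real.cosh_abs, Real.cosh_eq]
    linarith [Real.exp_pos (-|u|)]
  have hexp : Real.exp (-(2 * |u|)) = (Real.exp |u| ^ 2)⁻¹ := by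
    rw [Real.exp_neg, ← Real.exp_nat_mul]; norm_num
  calc sechSq u ≤ 1 / (Real.exp |u| / 2) ^ 2 := by rw [sechSq_eq]; gcongr
    _ = 4 * Real.exp (-(2 * |u|)) := by rw [hexp]; field_simp; norm_num

theorem integrable_pow_mul_sechSq (n : ℕ) : Integrable fun u : ℝ => u ^ n * sechSq u := by
  have hcont : Continuous fun u : ℝ => u ^ n * sechSq u := by fun_prop
  refine hcont.locallyIntegrable.integrable_of_isBigO_atTop_of_norm_isNegInvariant
    (.of_forall fun u => ?_) (g := fun u => Real.exp (-u)) ?_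
    ⟨Set.Ioi 0, Ioi_mem_atTop 0, integrableOn_exp_neg_Ioi 0⟩
  · simp only [Function.comp_apply, even_sechSq u, norm_mul, norm_pow, norm_neg]
  · have hsech : sechSq =O[atTop] fun u => Real.exp (-u) * Real.exp (-u) := by
      refine .of_bound 4 ?_
      filter_upwards [eventually_ge_atTop 0] with u hu
      rw [Real.norm_of_nonneg (sechSq_pos u).le, ← Real.exp_add,
        Real.norm_of_nonneg (by positivity)]
      convert sechSq_le_exp u using 3
      rw [abs_of_nonneg hu]; ring
    refine ((Real.isLittleO_pow_exp_atTop (n := n)).isBigO.mul hsech).congr_right fun u => ?_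
    rw [← mul_assoc, ← Real.exp_add, add_neg_cancel, Real.exp_zero, one_mul]

theorem integrable_pow_mul_mul_sechSq (n : ℕ) {f : ℝ → ℝ} (hf : Continuous f)
    (hbound : ∀ u, |f u| ≤ 1) : Integrable fun u : ℝ => u ^ n * (f u * sechSq u) :=
  ((integrable_pow_mul_sechSq n).bdd_mul hf.aestronglyMeasurable (.of_forall hbound)).congr
    (.of_forall fun _ => mul_left_comm _ _ _)

theorem hasIntegral_sechSq : HasIntegral sechSq 2 := by
  have hint : Integrable sechSq := by simpa using integrable_pow_mul_sechSq 0
  refine ⟨hint, ?_⟩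
  rw [integral_of_hasDerivAt_of_tendsto hasDerivAt_tanh hint tendsto_tanh_atBot tendsto_tanh_atTop]
  norm_num

theorem hasIntegral_mul_sechSq : HasIntegral (fun u => u * sechSq u) 0 :=
  hasIntegral_zero_of_odd (by simpa using integrable_pow_mul_sechSq 1)
    fun u => by rw [even_sechSq, neg_mul]

theorem hasIntegral_cube_mul_sechSq : HasIntegral (fun u => u ^ 3 * sechSq u) 0 :=
  hasIntegral_zero_of_odd (integrable_pow_mul_sechSq 3) fun u => by rw [even_sechSq]; ring

theorem hasIntegral_tanh_mul_sechSq : HasIntegral (fun u => Real.tanh u * sechSq u) 0 :=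
  hasIntegral_zero_of_odd
    (by simpa using integrable_pow_mul_mul_sechSq 0 continuous_tanh abs_tanh_le_one)
    fun u => by rw [even_sechSq, Real.tanh_neg, neg_mul]

theorem hasIntegral_mul_tanh_mul_sechSq :
    HasIntegral (fun u => u * (Real.tanh u * sechSq u)) 1 := by
  have hderiv (u : ℝ) : HasDerivAt (fun u => u * sechSq u)
      (-2 * (u * (Real.tanh u * sechSq u)) + sechSq u) u :=
    ((hasDerivAt_id' u).mul (hasDerivAt_sechSq u)).congr_deriv (by ring)
  exact .of_hasDerivAt hderiv hasIntegral_mul_sechSq.1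
    (by simpa using integrable_pow_mul_mul_sechSq 1 continuous_tanh abs_tanh_le_one)
    (by simpa using hasIntegral_sechSq) (by norm_num)

theorem hasIntegral_sechSq_sq : HasIntegral (fun u => sechSq u ^ 2) (4 / 3) := by
  have hderiv (u : ℝ) : HasDerivAt (fun u => Real.tanh u * sechSq u)
      (3 * sechSq u ^ 2 + -2 * sechSq u) u :=
    ((hasDerivAt_tanh u).mul (hasDerivAt_sechSq u)).congr_deriv (by simp only [sechSq]; ring)
  exact .of_hasDerivAt hderiv hasIntegral_tanh_mul_sechSq.1
    (by simpa [sq] using integrable_pow_mul_mul_sechSq 0 continuous_sechSq abs_sechSq_le_one)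
    (by convert hasIntegral_sechSq.const_mul (-2) using 1; norm_num) (by norm_num)

theorem hasIntegral_mul_sechSq_sq : HasIntegral (fun u => u * sechSq u ^ 2) 0 :=
  hasIntegral_zero_of_odd
    (by simpa [sq] using integrable_pow_mul_mul_sechSq 1 continuous_sechSq abs_sechSq_le_one)
    fun u => by rw [even_sechSq, neg_mul]

theorem hasSum_neg_one_pow_div_sq :
    HasSum (fun n : ℕ => (-1 : ℝ) ^ n / n ^ 2) (-(Real.pi ^ 2 / 12)) := by
  have hbernoulli : ((Polynomial.bernoulli 2).map (algebraMap ℚ ℝ)).eval (1 / 2) = -1 / 12 := by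
    norm_num [Polynomial.bernoulli, Finset.sum_range_succ, bernoulli_eq_bernoulli'_of_ne_one]
  have hsum := hasSum_one_div_nat_pow_mul_cos one_ne_zero (x := 1 / 2) (by norm_num)
  rw [mul_one, hbernoulli] at hsum
  convert hsum using 1
  · funext n
    rw [show 2 * Real.pi * n * (1 / 2) = n * Real.pi by ring, Real.cos_nat_mul_pi]
    ring
  · norm_num
    ring

theorem hasSum_sechSq {u : ℝ} (hu : 0 < u) :
    HasSum (fun n : ℕ => -4 * n * (-1) ^ n * Real.exp (-(2 * n) * u)) (sechSq u) := by
  have hr : ‖-Real.exp (-(2 * u))‖ < 1 := by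
    rw [norm_neg, Real.norm_of_nonneg (Real.exp_pos _).le, Real.exp_lt_one_iff]
    linarith
  have hvalue : sechSq u = -4 * (-Real.exp (-(2 * u)) / (1 - -Real.exp (-(2 * u))) ^ 2) := by
    have htanh : Real.tanh u = 1 - 2 * Real.exp (-(2 * u)) / (1 + Real.exp (-(2 * u))) := by
      rw [← one_sub_tanh_eq]; ring
    rw [sechSq, htanh, sub_neg_eq_add]
    field_simp
    ring
  rw [hvalue]
  refine ((hasSum_coe_mul_geometric_of_norm_lt_one hr).mul_left (-4)).congr_fun fun n => ?_
  rw [neg_pow (Real.exp _), ← Real.exp_nat_mul]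
  ring_nf

open Complex in
theorem mellin_sechSq_three : mellin (fun u => (sechSq u : ℂ)) 3 = (Real.pi ^ 2 / 12 : ℝ) := by
  have hmellin := hasSum_mellin (s := 3) (a := fun n : ℕ => ((-4 * n * (-1) ^ n : ℝ) : ℂ))
    (p := fun n : ℕ => 2 * n) (F := fun u => (sechSq u : ℂ))
    (fun n => n.eq_zero_or_pos.imp (by rintro rfl; simp) fun hn => by positivity) (by norm_num)
    (fun u hu => mod_cast hasSum_ofReal.2 (hasSum_sechSq hu)) ?_
  · refine hmellin.unique ((hasSum_ofReal.2 hasSum_neg_one_pow_div_sq.neg).congr_fun fun n => ?_)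
      |>.trans (by rw [neg_neg])
    have hGamma : Gamma 3 = 2 := Gamma_ofNat_eq_factorial 2
    rcases eq_or_ne n 0 with rfl | hn
    · simp
    have hn' : (n : ℂ) ≠ 0 := Nat.cast_ne_zero.2 hn
    rw [cpow_ofNat, hGamma]
    push_cast
    field_simp
    norm_num
  · refine ((Real.summable_one_div_nat_pow.2 one_lt_two).mul_left (1 / 2)).congr fun n => ?_
    rcases eq_or_ne n 0 with rfl | hn
    · simp
    have hnorm : ‖((-4 * n * (-1) ^ n : ℝ) : ℂ)‖ = 4 * n := by simp
    have hn' : (n : ℝ) ≠ 0 := Nat.cast_ne_zero.2 hn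
    rw [hnorm, re_ofNat, Real.rpow_ofNat]
    field_simp
    norm_num

theorem integral_Ioi_sq_mul_sechSq :
    ∫ u in Set.Ioi (0 : ℝ), u ^ 2 * sechSq u = Real.pi ^ 2 / 12 := by
  have h := mellin_sechSq_three
  rw [mellin] at h
  have (u : ℝ) : (u : ℂ) ^ ((3 : ℂ) - 1) • (sechSq u : ℂ) = ((u ^ 2 * sechSq u : ℝ) : ℂ) := by
    norm_num
  simp only [this] at h
  rw [integral_complex_ofReal] at h
  exact_mod_cast h

theorem hasIntegral_sq_mul_sechSq :
    HasIntegral (fun u => u ^ 2 * sechSq u) (Real.pi ^ 2 / 6) := by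
  refine ⟨integrable_pow_mul_sechSq 2, ?_⟩
  calc ∫ u, u ^ 2 * sechSq u = ∫ u, |u| ^ 2 * sechSq |u| := by
        refine integral_congr_ae (.of_forall fun u => ?_)
        rcases abs_choice u with h | h <;> simp only [h, even_sechSq u, neg_sq]
    _ = 2 * ∫ u in Set.Ioi (0 : ℝ), u ^ 2 * sechSq u :=
        integral_comp_abs (f := fun u => u ^ 2 * sechSq u)
    _ = Real.pi ^ 2 / 6 := by rw [integral_Ioi_sq_mul_sechSq]; ring

theorem hasIntegral_sq_mul_sechSq_sq :
    HasIntegral (fun u => u ^ 2 * sechSq u ^ 2) (Real.pi ^ 2 / 9 - 2 / 3) := by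
  have hderiv (u : ℝ) : HasDerivAt (fun u => u ^ 2 * (Real.tanh u * sechSq u) + u * sechSq u)
      (3 * (u ^ 2 * sechSq u ^ 2) + (sechSq u - 2 * (u ^ 2 * sechSq u))) u := by
    refine (((hasDerivAt_pow 2 u).mul ((hasDerivAt_tanh u).mul (hasDerivAt_sechSq u))).add
      ((hasDerivAt_id' u).mul (hasDerivAt_sechSq u))).congr_deriv ?_
    simp only [Pi.mul_apply, sechSq]
    push_cast
    ring
  refine .of_hasDerivAt hderiv ?_ ?_ ((hasIntegral_sechSq.sub
    (hasIntegral_sq_mul_sechSq.const_mul 2)).congr (fun _ => rfl) (by ring)) (by norm_num)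
  · exact (integrable_pow_mul_mul_sechSq 2 continuous_tanh abs_tanh_le_one).add
      hasIntegral_mul_sechSq.1
  · simpa [sq] using integrable_pow_mul_mul_sechSq 2 continuous_sechSq abs_sechSq_le_one

/-! ### The kink-antikink bump -/

/-- The kink-antikink profile `tanh (y + C) - tanh (y - C)` of unit steepness. -/
def bump (C y : ℝ) : ℝ := Real.tanh (y + C) - Real.tanh (y + -C)

/-- The derivative of `bump C y` in `C`. -/
def bumpSum (C y : ℝ) : ℝ := sechSq (y + C) + sechSq (y + -C)

/-- The derivative of `bump C y` in `y`. -/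
def bumpDiff (C y : ℝ) : ℝ := sechSq (y + C) - sechSq (y + -C)

/-- `coth (2 C)`, through which alone the spatial integrals depend transcendentally on `C`. -/
def cothTwo (C : ℝ) : ℝ := (Real.tanh (2 * C))⁻¹

theorem tanh_pos {x : ℝ} (hx : 0 < x) : 0 < Real.tanh x := by
  rw [Real.tanh_eq_sinh_div_cosh]
  exact div_pos (Real.sinh_pos_iff.2 hx) (Real.cosh_pos x)

theorem hasDerivAt_cothTwo {C : ℝ} (hC : 0 < C) :
    HasDerivAt cothTwo (-2 * (cothTwo C ^ 2 - 1)) C := by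
  have h0 : Real.tanh (2 * C) ≠ 0 := (tanh_pos (by linarith)).ne'
  have h1 : HasDerivAt (fun C => Real.tanh (2 * C)) (sechSq (2 * C) * (2 * 1)) C :=
    (hasDerivAt_tanh (2 * C)).comp C ((hasDerivAt_id C).const_mul 2)
  refine (h1.inv h0).congr_deriv ?_
  rw [cothTwo, sechSq]
  field_simp

theorem hasDerivAt_bump (C y : ℝ) : HasDerivAt (bump C) (bumpDiff C y) y := by
  have h (c : ℝ) := (hasDerivAt_tanh (y + c)).comp y ((hasDerivAt_id y).add_const c)
  refine ((h C).sub (h (-C))).congr_deriv ?_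
  rw [mul_one, mul_one, bumpDiff]

theorem bump_eq (C y : ℝ) :
    bump C y = Real.sinh (2 * C) / (Real.cosh (y + C) * Real.cosh (y + -C)) := by
  rw [show 2 * C = (y + C) - (y + -C) by ring, Real.sinh_sub, bump, Real.tanh_eq_sinh_div_cosh,
    Real.tanh_eq_sinh_div_cosh]
  field_simp

theorem continuous_bump (C : ℝ) : Continuous (bump C) := by
  unfold bump
  fun_prop

theorem abs_bump_le (C y : ℝ) : |bump C y| ≤ |Real.sinh (2 * C)| * sechSq y := by
  have hcosh : Real.cosh y ^ 2 ≤ Real.cosh (y + C) * Real.cosh (y + -C) := by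
    rw [Real.cosh_add, Real.cosh_add, Real.cosh_neg, Real.sinh_neg]
    nlinarith [Real.cosh_sq C, Real.cosh_sq y, sq_nonneg (Real.sinh C)]
  rw [bump_eq, abs_div, abs_of_pos (mul_pos (Real.cosh_pos (y + C)) (Real.cosh_pos (y + -C))),
    sechSq_eq, mul_one_div]
  gcongr

theorem integrable_pow_mul_bump (C : ℝ) (n : ℕ) : Integrable fun y => y ^ n * bump C y := by
  refine ((integrable_pow_mul_sechSq n).norm.const_mul |Real.sinh (2 * C)|).mono'
    (((continuous_id.pow n).mul (continuous_bump C)).aestronglyMeasurable)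
    (ae_of_all _ fun y => ?_)
  calc ‖y ^ n * bump C y‖ = ‖y ^ n‖ * |bump C y| := norm_mul _ _
    _ ≤ ‖y ^ n‖ * (|Real.sinh (2 * C)| * sechSq y) := by gcongr; exact abs_bump_le C y
    _ = |Real.sinh (2 * C)| * ‖y ^ n * sechSq y‖ := by
      rw [norm_mul, Real.norm_of_nonneg (sechSq_pos y).le]; ring

/-- The addition theorem of `coth`, which makes products of `bump C` and its derivatives
linear combinations of simpler ones. -/
theorem cothTwo_mul_bump {C : ℝ} (hC : 0 < C) (y : ℝ) :
    cothTwo C * bump C y = 1 - Real.tanh (y + C) * Real.tanh (y + -C) := by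
  calc cothTwo C * bump C y
      = Real.cosh ((y + C) - (y + -C)) / (Real.cosh (y + C) * Real.cosh (y + -C)) := by
        rw [cothTwo, Real.tanh_eq_sinh_div_cosh, inv_div, bump_eq,
          show (y + C) - (y + -C) = 2 * C by ring]
        field_simp
    _ = 1 - Real.tanh (y + C) * Real.tanh (y + -C) := by
        rw [Real.cosh_sub, Real.tanh_eq_sinh_div_cosh, Real.tanh_eq_sinh_div_cosh]
        field_simp

theorem bump_sq {C : ℝ} (hC : 0 < C) (y : ℝ) :
    bump C y ^ 2 = 2 * cothTwo C * bump C y - bumpSum C y := by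
  have h := cothTwo_mul_bump hC y
  unfold bumpSum sechSq
  unfold bump at h ⊢
  linear_combination (-2) * h

theorem sechSq_mul_sechSq {C : ℝ} (hC : 0 < C) (y : ℝ) :
    sechSq (y + C) * sechSq (y + -C) = (cothTwo C ^ 2 - 1) * bump C y ^ 2 := by
  have h := cothTwo_mul_bump hC y
  unfold sechSq
  unfold bump at h ⊢
  linear_combination
    (-(cothTwo C * (Real.tanh (y + C) - Real.tanh (y + -C)) + 1
      - Real.tanh (y + C) * Real.tanh (y + -C))) * h

theorem bump_mul_sechSq_left {C : ℝ} (hC : 0 < C) (y : ℝ) :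
    bump C y * sechSq (y + C) = Real.tanh (y + C) * sechSq (y + C)
      - (cothTwo C ^ 2 - 1) * bump C y + cothTwo C * sechSq (y + C) := by
  have h := cothTwo_mul_bump hC y
  unfold sechSq
  unfold bump at h ⊢
  linear_combination (Real.tanh (y + C) + cothTwo C) * h

theorem bump_mul_sechSq_right {C : ℝ} (hC : 0 < C) (y : ℝ) :
    bump C y * sechSq (y + -C) = -(Real.tanh (y + -C) * sechSq (y + -C))
      - (cothTwo C ^ 2 - 1) * bump C y + cothTwo C * sechSq (y + -C) := by
  have h := cothTwo_mul_bump hC y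
  unfold sechSq
  unfold bump at h ⊢
  linear_combination (cothTwo C - Real.tanh (y + -C)) * h

/-! ### Moments of the bump -/

/-- `∫ T²` for `T = bump C`. As in all the moments below, `k` stands for `coth (2 C)` and is
kept as a separate argument because the asymptotic analysis replaces it by `1`. -/
def momentSq (k C : ℝ) : ℝ := 8 * k * C - 4

/-- `∫ T ∂_C T`. -/
def momentMix (k C : ℝ) : ℝ := 4 * k - 8 * (k ^ 2 - 1) * C

/-- `∫ y² T`. -/
def momentTwo (C : ℝ) : ℝ := 4 / 3 * C ^ 3 + Real.pi ^ 2 / 3 * C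

/-- `∫ y² T²`. -/
def momentTwoSq (k C : ℝ) : ℝ := 2 * k * momentTwo C - (Real.pi ^ 2 / 3 + 4 * C ^ 2)

/-- `∫ (∂_C T)²`. -/
def momentSum (k C : ℝ) : ℝ := 8 / 3 + 2 * (k ^ 2 - 1) * momentSq k C

/-- `∫ y² (∂_y T)²`. -/
def momentDiff (k C : ℝ) : ℝ :=
  2 * (Real.pi ^ 2 / 9 - 2 / 3) + 8 / 3 * C ^ 2 - 2 * (k ^ 2 - 1) * momentTwoSq k C

/-- `∫ T³`. -/
def momentCube (k C : ℝ) : ℝ := 2 * k * momentSq k C - momentMix k C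

/-- `∫ T⁴`. -/
def momentQuartic (k C : ℝ) : ℝ :=
  4 * k ^ 2 * momentSq k C - 4 * k * momentMix k C + momentSum k C

theorem hasIntegral_bump (C : ℝ) : HasIntegral (bump C) (4 * C) := by
  have hpow := integrable_pow_mul_bump C
  refine .of_hasDerivAt (F := fun y => y * bump C y) (c := 1) (g := fun y => y * bumpDiff C y)
    (fun y => ?_) (by simpa only [pow_one] using hpow 1)
    (by simpa only [pow_zero, one_mul] using hpow 0) ?_ one_ne_zero
  · exact (hasDerivAt_id y).mul (hasDerivAt_bump C y)
  · exact ((hasIntegral_sechSq.mul_comp_add C hasIntegral_mul_sechSq).sub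
      (hasIntegral_sechSq.mul_comp_add (-C) hasIntegral_mul_sechSq)).congr
      (fun y => by rw [bumpDiff, mul_sub]) (by ring)

theorem hasIntegral_sq_mul_bump (C : ℝ) :
    HasIntegral (fun y => y ^ 2 * bump C y) (momentTwo C) := by
  have hpow := integrable_pow_mul_bump C
  refine .of_hasDerivAt (F := fun y => y ^ 3 * bump C y) (c := 3)
    (g := fun y => y ^ 3 * bumpDiff C y) (fun y => ?_) (hpow 3) (hpow 2) ?_ three_ne_zero
  · refine (((hasDerivAt_id y).pow 3).mul (hasDerivAt_bump C y)).congr_deriv ?_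
    simp only [id, Nat.cast_ofNat, Pi.pow_apply]; ring
  · have hsech (c : ℝ) := hasIntegral_sechSq.cube_mul_comp_add c hasIntegral_mul_sechSq
      hasIntegral_sq_mul_sechSq hasIntegral_cube_mul_sechSq
    exact ((hsech C).sub (hsech (-C))).congr (fun y => by rw [bumpDiff, mul_sub])
      (by rw [momentTwo]; ring)

theorem hasIntegral_bumpSum (C : ℝ) : HasIntegral (bumpSum C) 4 :=
  ((hasIntegral_sechSq.comp_add C).add (hasIntegral_sechSq.comp_add (-C))).congr
    (fun _ => rfl) (by norm_num)

theorem hasIntegral_mul_bumpDiff_mul_bumpSum (C : ℝ) :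
    HasIntegral (fun y => y * (bumpDiff C y * bumpSum C y)) (-(8 / 3) * C) :=
  ((hasIntegral_sechSq_sq.mul_comp_add C hasIntegral_mul_sechSq_sq).sub
    (hasIntegral_sechSq_sq.mul_comp_add (-C) hasIntegral_mul_sechSq_sq)).congr
    (fun y => by rw [bumpDiff, bumpSum]; ring) (by ring)

section Moments

variable {C : ℝ} (hC : 0 < C)
include hC

theorem hasIntegral_bump_sq :
    HasIntegral (fun y => bump C y ^ 2) (momentSq (cothTwo C) C) :=
  (((hasIntegral_bump C).const_mul (2 * cothTwo C)).sub (hasIntegral_bumpSum C)).congr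
    (bump_sq hC) (by rw [momentSq]; ring)

theorem hasIntegral_sq_mul_bump_sq :
    HasIntegral (fun y => y ^ 2 * bump C y ^ 2) (momentTwoSq (cothTwo C) C) := by
  have hsech (c : ℝ) :=
    hasIntegral_sechSq.sq_mul_comp_add c hasIntegral_mul_sechSq hasIntegral_sq_mul_sechSq
  exact (((hasIntegral_sq_mul_bump C).const_mul (2 * cothTwo C)).sub
    ((hsech C).add (hsech (-C)))).congr
    (fun y => by rw [bump_sq hC, bumpSum]; ring) (by rw [momentTwoSq]; ring)

theorem hasIntegral_bump_mul_bumpSum :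
    HasIntegral (fun y => bump C y * bumpSum C y) (momentMix (cothTwo C) C) := by
  have htanh := hasIntegral_tanh_mul_sechSq.comp_add
  exact ((((htanh C).sub (htanh (-C))).sub
    ((hasIntegral_bump C).const_mul (2 * (cothTwo C ^ 2 - 1)))).add
    ((hasIntegral_bumpSum C).const_mul (cothTwo C))).congr
    (fun y => by
      rw [bumpSum, mul_add, bump_mul_sechSq_left hC, bump_mul_sechSq_right hC]; ring)
    (by rw [momentMix]; ring)

theorem hasIntegral_bump_cube :
    HasIntegral (fun y => bump C y ^ 3) (momentCube (cothTwo C) C) :=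
  (((hasIntegral_bump_sq hC).const_mul (2 * cothTwo C)).sub
    (hasIntegral_bump_mul_bumpSum hC)).congr
    (fun y => by linear_combination bump C y * bump_sq hC y) rfl

theorem hasIntegral_bumpSum_sq :
    HasIntegral (fun y => bumpSum C y ^ 2) (momentSum (cothTwo C) C) :=
  (((hasIntegral_sechSq_sq.comp_add C).add (hasIntegral_sechSq_sq.comp_add (-C))).add
    ((hasIntegral_bump_sq hC).const_mul (2 * (cothTwo C ^ 2 - 1)))).congr
    (fun y => by rw [bumpSum]; linear_combination 2 * sechSq_mul_sechSq hC y)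
    (by rw [momentSum]; ring)

theorem hasIntegral_bumpDiff_sq :
    HasIntegral (fun y => bumpDiff C y ^ 2) (16 / 3 - momentSum (cothTwo C) C) :=
  (((hasIntegral_sechSq_sq.comp_add C).add (hasIntegral_sechSq_sq.comp_add (-C))).sub
    ((hasIntegral_bump_sq hC).const_mul (2 * (cothTwo C ^ 2 - 1)))).congr
    (fun y => by rw [bumpDiff]; linear_combination (-2) * sechSq_mul_sechSq hC y)
    (by rw [momentSum]; ring)

theorem hasIntegral_bump_pow_four :
    HasIntegral (fun y => bump C y ^ 4) (momentQuartic (cothTwo C) C) :=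
  ((((hasIntegral_bump_sq hC).const_mul (4 * cothTwo C ^ 2)).sub
    ((hasIntegral_bump_mul_bumpSum hC).const_mul (4 * cothTwo C))).add
    (hasIntegral_bumpSum_sq hC)).congr
    (fun y => by
      linear_combination (bump C y ^ 2 + 2 * cothTwo C * bump C y - bumpSum C y) * bump_sq hC y)
    rfl

theorem hasIntegral_sq_mul_bumpDiff_sq :
    HasIntegral (fun y => y ^ 2 * bumpDiff C y ^ 2) (momentDiff (cothTwo C) C) := by
  have hsech (c : ℝ) := hasIntegral_sechSq_sq.sq_mul_comp_add c hasIntegral_mul_sechSq_sq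
    hasIntegral_sq_mul_sechSq_sq
  exact (((hsech C).add (hsech (-C))).sub
    ((hasIntegral_sq_mul_bump_sq hC).const_mul (2 * (cothTwo C ^ 2 - 1)))).congr
    (fun y => by rw [bumpDiff]; linear_combination (-2 * y ^ 2) * sechSq_mul_sechSq hC y)
    (by rw [momentDiff]; ring)

theorem hasIntegral_mul_bump_mul_bumpDiff :
    HasIntegral (fun y => y * (bump C y * bumpDiff C y)) (-(momentSq (cothTwo C) C / 2)) := by
  have htanh (c : ℝ) :=
    hasIntegral_tanh_mul_sechSq.mul_comp_add c hasIntegral_mul_tanh_mul_sechSq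
  have hsech (c : ℝ) := hasIntegral_sechSq.mul_comp_add c hasIntegral_mul_sechSq
  exact (((htanh C).add (htanh (-C))).add
    (((hsech C).sub (hsech (-C))).const_mul (cothTwo C))).congr
    (fun y => by
      rw [bumpDiff, mul_sub (bump C y), bump_mul_sechSq_left hC, bump_mul_sechSq_right hC]; ring)
    (by rw [momentSq]; ring)

end Moments

/-! ### Derivatives of the moments -/

/-- The derivative of `momentTwoSq` in `C` along `k = coth (2 C)`. -/
def momentTwoSqDeriv (k C : ℝ) : ℝ :=
  2 * k * (4 * C ^ 2 + Real.pi ^ 2 / 3) - 8 * C - 4 * (k ^ 2 - 1) * momentTwo C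

/-- The derivative of `momentDiff` in `C` along `k = coth (2 C)`. -/
def momentDiffDeriv (k C : ℝ) : ℝ :=
  16 / 3 * C + (k ^ 2 - 1) * (8 * k * momentTwoSq k C - 2 * momentTwoSqDeriv k C)

/-- The derivative of `momentQuartic` in `C` along `k = coth (2 C)`. -/
def momentQuarticDeriv (k C : ℝ) : ℝ :=
  (20 * k ^ 2 - 12) * momentMix k C - 40 * k * (k ^ 2 - 1) * momentSq k C

section MomentDerivatives

variable {C : ℝ} (hC : 0 < C)
include hC

theorem hasDerivAt_cothTwo_sq_sub_one :
    HasDerivAt (fun C => cothTwo C ^ 2 - 1) (-4 * cothTwo C * (cothTwo C ^ 2 - 1)) C := by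
  refine (((hasDerivAt_cothTwo hC).pow 2).sub_const 1).congr_deriv ?_
  push_cast
  ring

theorem hasDerivAt_momentSq :
    HasDerivAt (fun C => momentSq (cothTwo C) C) (2 * momentMix (cothTwo C) C) C := by
  refine ((((hasDerivAt_cothTwo hC).const_mul 8).mul (hasDerivAt_id C)).sub_const 4).congr_deriv ?_
  simp only [momentMix, id]; ring

theorem hasDerivAt_momentMix :
    HasDerivAt (fun C => momentMix (cothTwo C) C)
      (4 * (cothTwo C ^ 2 - 1) * momentSq (cothTwo C) C) C := by
  refine (((hasDerivAt_cothTwo hC).const_mul 4).sub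
    (((hasDerivAt_cothTwo_sq_sub_one hC).const_mul 8).mul (hasDerivAt_id C))).congr_deriv ?_
  simp only [momentSq, id]; ring

theorem hasDerivAt_momentTwoSq :
    HasDerivAt (fun C => momentTwoSq (cothTwo C) C) (momentTwoSqDeriv (cothTwo C) C) C := by
  have hi := hasDerivAt_id C
  have hTwo : HasDerivAt momentTwo (4 * C ^ 2 + Real.pi ^ 2 / 3) C := by
    refine (((hi.pow 3).const_mul (4 / 3)).add
      (hi.const_mul (Real.pi ^ 2 / 3))).congr_deriv ?_
    simp only [id]; push_cast; ring
  refine ((((hasDerivAt_cothTwo hC).const_mul 2).mul hTwo).sub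
    (((hi.pow 2).const_mul 4).const_add (Real.pi ^ 2 / 3))).congr_deriv ?_
  simp only [momentTwoSqDeriv, id]; push_cast; ring

theorem hasDerivAt_momentSum :
    HasDerivAt (fun C => momentSum (cothTwo C) C)
      (-4 * (cothTwo C ^ 2 - 1) * momentCube (cothTwo C) C) C := by
  refine ((((hasDerivAt_cothTwo_sq_sub_one hC).const_mul 2).mul
    (hasDerivAt_momentSq hC)).const_add (8 / 3)).congr_deriv ?_
  simp only [momentCube]; ring

theorem hasDerivAt_momentDiff :
    HasDerivAt (fun C => momentDiff (cothTwo C) C) (momentDiffDeriv (cothTwo C) C) C := by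
  refine ((((hasDerivAt_pow 2 C).const_mul (8 / 3)).const_add _).sub
    (((hasDerivAt_cothTwo_sq_sub_one hC).const_mul 2).mul
      (hasDerivAt_momentTwoSq hC))).congr_deriv ?_
  simp only [momentDiffDeriv]; push_cast; ring

theorem hasDerivAt_momentCube :
    HasDerivAt (fun C => momentCube (cothTwo C) C) (4 * cothTwo C * momentMix (cothTwo C) C
      - 8 * (cothTwo C ^ 2 - 1) * momentSq (cothTwo C) C) C := by
  refine ((((hasDerivAt_cothTwo hC).const_mul 2).mul (hasDerivAt_momentSq hC)).sub
    (hasDerivAt_momentMix hC)).congr_deriv ?_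
  ring

theorem hasDerivAt_momentQuartic :
    HasDerivAt (fun C => momentQuartic (cothTwo C) C) (momentQuarticDeriv (cothTwo C) C) C := by
  have hk := hasDerivAt_cothTwo hC
  refine (((((hk.pow 2).const_mul 4).mul (hasDerivAt_momentSq hC)).sub
    ((hk.const_mul 4).mul (hasDerivAt_momentMix hC))).add
    (hasDerivAt_momentSum hC)).congr_deriv ?_
  simp only [momentQuarticDeriv, momentCube, Pi.pow_apply]; push_cast; ring

end MomentDerivatives

/-! ### The effective Lagrangian in closed form -/

/-- `∫ φ_t²` of the moving profile, where `k = coth (2 C)`. -/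
def kineticForm (k A B C A' B' C' : ℝ) : ℝ :=
  (A' ^ 2 / 4 * momentSq k C + A ^ 2 / 4 * (B' / B) ^ 2 * momentDiff k C
    + A ^ 2 / 4 * C' ^ 2 * momentSum k C - A * A' / 4 * (B' / B) * momentSq k C
    + A * A' / 2 * C' * momentMix k C - 4 / 3 * A ^ 2 * (B' / B) * C' * C) / B

/-- `∫ (φ_x² / 2 + V(φ))` of the profile, where `k = coth (2 C)` and `c` is the coefficient of
`-φ³` in `V`. -/
def staticForm (c k A B C : ℝ) : ℝ :=
  A ^ 2 * B / 8 * (16 / 3 - momentSum k C)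
    + (A ^ 4 / 8 * momentQuartic k C - c * A ^ 3 / 8 * momentCube k C
      + A ^ 2 / 2 * momentSq k C) / B

theorem profile_eq (A B C x : ℝ) : profile A B C x = A / 2 * bump C (B * x) := by
  rw [profile, bump, sub_eq_add_neg (B * x) C]

theorem hasDerivAt_profile_line {A B C : ℝ → ℝ} {A' B' C' t : ℝ} (hA : HasDerivAt A A' t)
    (hB : HasDerivAt B B' t) (hC : HasDerivAt C C' t) (x : ℝ) :
    HasDerivAt (fun s => profile (A s) (B s) (C s) x)
      (A' / 2 * bump (C t) (B t * x) + A t / 2 * (B' * x * bumpDiff (C t) (B t * x)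
        + C' * bumpSum (C t) (B t * x))) t := by
  simp only [profile]
  have hleft := (hasDerivAt_tanh (B t * x + C t)).comp t ((hB.mul_const x).add hC)
  have hright := (hasDerivAt_tanh (B t * x - C t)).comp t ((hB.mul_const x).sub hC)
  refine ((hA.div_const 2).mul (hleft.sub hright)).congr_deriv ?_
  simp only [bump, bumpDiff, bumpSum, Pi.sub_apply, Pi.add_apply, Function.comp,
    sub_eq_add_neg (B t * x) (C t)]
  ring

theorem profileVelocity_eq (A B C A' B' C' x : ℝ) :
    profileVelocity A B C A' B' C' x = A' / 2 * bump C (B * x)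
      + A / 2 * (B' * x * bumpDiff C (B * x) + C' * bumpSum C (B * x)) := by
  have hline (p p' : ℝ) : HasDerivAt (fun s : ℝ => p + s * p') p' 0 := by
    simpa only [one_mul, id] using ((hasDerivAt_id (0 : ℝ)).mul_const p').const_add p
  simpa only [profileVelocity, zero_mul, add_zero] using
    (hasDerivAt_profile_line (hline A A') (hline B B') (hline C C') x).deriv

theorem deriv_profile (A B C x : ℝ) :
    deriv (profile A B C) x = A / 2 * (B * bumpDiff C (B * x)) := by
  have hbump : HasDerivAt (fun x => bump C (B * x)) (bumpDiff C (B * x) * (B * 1)) x :=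
    (hasDerivAt_bump C (B * x)).comp x ((hasDerivAt_id x).const_mul B)
  rw [funext (profile_eq A B C), (hbump.const_mul (A / 2)).deriv]
  ring

theorem hasIntegral_profileVelocity_sq (A : ℝ) {B C : ℝ} (hB : 0 < B) (hC : 0 < C)
    (A' B' C' : ℝ) :
    HasIntegral (fun x => (profileVelocity A B C A' B' C' x) ^ 2)
      (kineticForm (cothTwo C) A B C A' B' C') := by
  have h := ((((((hasIntegral_bump_sq hC).const_mul (A' ^ 2 / 4)).add
    ((hasIntegral_sq_mul_bumpDiff_sq hC).const_mul (A ^ 2 / 4 * (B' / B) ^ 2))).add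
    ((hasIntegral_bumpSum_sq hC).const_mul (A ^ 2 / 4 * C' ^ 2))).add
    ((hasIntegral_mul_bump_mul_bumpDiff hC).const_mul (A * A' / 2 * (B' / B)))).add
    ((hasIntegral_bump_mul_bumpSum hC).const_mul (A * A' / 2 * C'))).add
    ((hasIntegral_mul_bumpDiff_mul_bumpSum C).const_mul (A ^ 2 / 2 * (B' / B) * C'))
  refine (h.comp_mul hB).congr (fun x => ?_) ?_
  · rw [profileVelocity_eq]; field_simp; ring
  · rw [kineticForm]; ring

section Potential

variable {a c : ℝ} (ha : 0 < a) (hc : 2 * (Real.tanh a + (Real.tanh a)⁻¹) = c)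
include ha hc

theorem potential_eq (φ : ℝ) : potential a φ = 2 * φ ^ 4 - c * φ ^ 3 + 2 * φ ^ 2 := by
  have htanh : Real.tanh a * (Real.tanh a)⁻¹ = 1 := mul_inv_cancel₀ (tanh_pos ha).ne'
  rw [potential]
  linear_combination (-φ ^ 3) * hc + 2 * φ ^ 2 * htanh

theorem hasIntegral_staticForm (A : ℝ) {B C : ℝ} (hB : 0 < B) (hC : 0 < C) :
    HasIntegral (fun x => 1 / 2 * (deriv (profile A B C) x) ^ 2 + potential a (profile A B C x))
      (staticForm c (cothTwo C) A B C) := by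
  have h := ((((hasIntegral_bumpDiff_sq hC).const_mul (A ^ 2 * B ^ 2 / 8)).add
    ((hasIntegral_bump_pow_four hC).const_mul (A ^ 4 / 8))).sub
    ((hasIntegral_bump_cube hC).const_mul (c * A ^ 3 / 8))).add
    ((hasIntegral_bump_sq hC).const_mul (A ^ 2 / 2))
  refine (h.comp_mul hB).congr (fun x => ?_) ?_
  · rw [deriv_profile, potential_eq ha hc, profile_eq]; ring
  · rw [staticForm]; field_simp; ring

theorem effLagrangian_eq (A : ℝ) {B C : ℝ} (hB : 0 < B) (hC : 0 < C) (A' B' C' : ℝ) :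
    effLagrangian a A B C A' B' C' = -(1 / 2) * kineticForm (cothTwo C) A B C A' B' C'
      + staticForm c (cothTwo C) A B C := by
  rw [← (((hasIntegral_profileVelocity_sq A hB hC A' B' C').const_mul (-(1 / 2))).add
    (hasIntegral_staticForm ha hc A hB hC)).2, effLagrangian]
  simp only [add_assoc]

theorem fieldEnergy_eq {A B X : ℝ → ℝ} {A' B' X' t : ℝ} (hA : HasDerivAt A A' t)
    (hB : HasDerivAt B B' t) (hX : HasDerivAt X X' t) (hB0 : 0 < B t) (hX0 : 0 < X t) :
    fieldEnergy a (lump A B X) t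
      = 1 / 2 * kineticForm (cothTwo (B t * X t)) (A t) (B t) (B t * X t) A' B'
          (B' * X t + B t * X')
        + staticForm c (cothTwo (B t * X t)) (A t) (B t) (B t * X t) := by
  have hC0 := mul_pos hB0 hX0
  have hlump (s x : ℝ) : lump A B X x s = profile (A s) (B s) (B s * X s) x := by
    rw [lump, profile, mul_add, mul_sub]; ring_nf
  rw [← (((hasIntegral_profileVelocity_sq (A t) hB0 hC0 A' B'
    (B' * X t + B t * X')).const_mul (1 / 2)).add
    (hasIntegral_staticForm ha hc (A t) hB0 hC0)).2, fieldEnergy]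
  refine integral_congr_ae (ae_of_all _ fun x => ?_)
  simp only [hlump]
  have hC : HasDerivAt (fun s => B s * X s) (B' * X t + B t * X') t := hB.mul hX
  rw [(hasDerivAt_profile_line hA hB hC x).deriv, profileVelocity_eq]
  simp only [add_assoc]

end Potential

theorem tanh_add_inv_tanh {a b : ℝ} (ha : 0 < a)
    (hab : Real.tanh (2 * a) = 3 * b / (2 + b ^ 2)) (hb : 0 < b) :
    2 * (Real.tanh a + (Real.tanh a)⁻¹) = 4 * (2 + b ^ 2) / (3 * b) := by
  have hdouble : Real.tanh a + (Real.tanh a)⁻¹ = 2 * (Real.tanh (2 * a))⁻¹ := by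
    rw [Real.tanh_eq_sinh_div_cosh, Real.tanh_eq_sinh_div_cosh, Real.sinh_two_mul,
      Real.cosh_two_mul]
    field_simp
    ring
  rw [hdouble, hab]
  field_simp
  ring

/-! ### The Euler-Lagrange expressions -/

section EulerLagrange

variable (c k A A₁ A₂ B B₁ B₂ C C₁ C₂ : ℝ)

/-- `∂L/∂A`, where `k = coth (2 C)`. -/
def forceA : ℝ :=
  -(1 / 2) * ((A / 2 * (B₁ / B) ^ 2 * momentDiff k C + A / 2 * C₁ ^ 2 * momentSum k C
      - A₁ / 4 * (B₁ / B) * momentSq k C + A₁ / 2 * C₁ * momentMix k C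
      - 8 / 3 * A * (B₁ / B) * C₁ * C) / B)
    + A * B / 4 * (16 / 3 - momentSum k C)
    + (A ^ 3 / 2 * momentQuartic k C - 3 / 8 * c * A ^ 2 * momentCube k C + A * momentSq k C) / B

/-- `∂L/∂A'`, where `k = coth (2 C)`. -/
def momentumA : ℝ :=
  -(1 / 2) * ((A₁ / 2 * momentSq k C - A / 4 * (B₁ / B) * momentSq k C
    + A / 2 * C₁ * momentMix k C) / B)

/-- `d/dt (∂L/∂A')` along a curve, in terms of its first two time derivatives. -/
def momentumRateA : ℝ :=
  -(1 / 2) * ((A₂ / 2 * momentSq k C + A₁ * C₁ * momentMix k C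
      - (A₁ * B₁ + A * B₂) / 4 / B * momentSq k C - A * B₁ * C₁ / 2 / B * momentMix k C
      + A * B₁ ^ 2 / 4 / B ^ 2 * momentSq k C + (A₁ * C₁ + A * C₂) / 2 * momentMix k C
      + 2 * A * C₁ ^ 2 * (k ^ 2 - 1) * momentSq k C) / B
    - B₁ / B ^ 2 * (A₁ / 2 * momentSq k C - A / 4 * (B₁ / B) * momentSq k C
      + A / 2 * C₁ * momentMix k C))

/-- `∂L/∂B`, where `k = coth (2 C)`. -/
def forceB : ℝ :=
  -(1 / 2) * (-(A₁ ^ 2 / 4 / B ^ 2 * momentSq k C)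
      - 3 / 4 * A ^ 2 * B₁ ^ 2 / B ^ 4 * momentDiff k C
      - A ^ 2 * C₁ ^ 2 / 4 / B ^ 2 * momentSum k C + A * A₁ * B₁ / 2 / B ^ 3 * momentSq k C
      - A * A₁ * C₁ / 2 / B ^ 2 * momentMix k C + 8 / 3 * A ^ 2 * B₁ * C₁ * C / B ^ 3)
    + A ^ 2 / 8 * (16 / 3 - momentSum k C)
    - (A ^ 4 / 8 * momentQuartic k C - c * A ^ 3 / 8 * momentCube k C
      + A ^ 2 / 2 * momentSq k C) / B ^ 2

/-- `∂L/∂B'`, where `k = coth (2 C)`. -/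
def momentumB : ℝ :=
  -(1 / 2) * ((A ^ 2 * B₁ / 2 * momentDiff k C) / B ^ 3
    - (A * A₁ / 4 * momentSq k C + 4 / 3 * (A ^ 2 * C₁ * C)) / B ^ 2)

/-- `d/dt (∂L/∂B')` along a curve, in terms of its first two time derivatives. -/
def momentumRateB : ℝ :=
  -(1 / 2) * (A * A₁ * B₁ / B ^ 3 * momentDiff k C + A ^ 2 * B₂ / 2 / B ^ 3 * momentDiff k C
    + A ^ 2 * B₁ * C₁ / 2 / B ^ 3 * momentDiffDeriv k C
    - 3 / 2 * A ^ 2 * B₁ ^ 2 / B ^ 4 * momentDiff k C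
    - (A₁ ^ 2 + A * A₂) / 4 / B ^ 2 * momentSq k C - A * A₁ * C₁ / 2 / B ^ 2 * momentMix k C
    + A * A₁ * B₁ / 2 / B ^ 3 * momentSq k C
    - 4 / 3 * (2 * A * A₁ * C₁ * C + A ^ 2 * C₂ * C + A ^ 2 * C₁ ^ 2) / B ^ 2
    + 8 / 3 * A ^ 2 * C₁ * C * B₁ / B ^ 3)

/-- `∂L/∂C`, including the dependence of `k = coth (2 C)` on `C`. -/
def forceC : ℝ :=
  -(1 / 2) * ((A₁ ^ 2 / 2 * momentMix k C + A ^ 2 / 4 * (B₁ / B) ^ 2 * momentDiffDeriv k C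
      - A ^ 2 * C₁ ^ 2 * (k ^ 2 - 1) * momentCube k C - A * A₁ / 2 * (B₁ / B) * momentMix k C
      + 2 * A * A₁ * C₁ * (k ^ 2 - 1) * momentSq k C - 4 / 3 * A ^ 2 * (B₁ / B) * C₁) / B)
    + A ^ 2 * B / 2 * (k ^ 2 - 1) * momentCube k C
    + (A ^ 4 / 8 * momentQuarticDeriv k C
      - c * A ^ 3 / 8 * (4 * k * momentMix k C - 8 * (k ^ 2 - 1) * momentSq k C)
      + A ^ 2 * momentMix k C) / B

/-- `∂L/∂C'`, where `k = coth (2 C)`. -/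
def momentumC : ℝ :=
  -(1 / 2) * ((A ^ 2 * C₁ / 2 * momentSum k C + A * A₁ / 2 * momentMix k C) / B
    - (4 / 3 * (A ^ 2 * B₁ * C)) / B ^ 2)

/-- `d/dt (∂L/∂C')` along a curve, in terms of its first two time derivatives. -/
def momentumRateC : ℝ :=
  -(1 / 2) * ((A * A₁ * C₁ * momentSum k C + A ^ 2 / 2 * C₂ * momentSum k C
      - 2 * A ^ 2 * C₁ ^ 2 * (k ^ 2 - 1) * momentCube k C
      + (A₁ ^ 2 + A * A₂) / 2 * momentMix k C
      + 2 * A * A₁ * C₁ * (k ^ 2 - 1) * momentSq k C) / B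
    - B₁ / B ^ 2 * (A ^ 2 / 2 * C₁ * momentSum k C + A * A₁ / 2 * momentMix k C)
    - 4 / 3 * (2 * A * A₁ * B₁ * C + A ^ 2 * B₂ * C + A ^ 2 * B₁ * C₁) / B ^ 2
    + 8 / 3 * A ^ 2 * B₁ ^ 2 * C / B ^ 3)

/-- The `A` component of the Euler-Lagrange expression. -/
def eulerLagrangeA : ℝ :=
  forceA c k A A₁ B B₁ C C₁ - momentumRateA k A A₁ A₂ B B₁ B₂ C C₁ C₂

/-- The `B` component of the Euler-Lagrange expression. -/
def eulerLagrangeB : ℝ :=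
  forceB c k A A₁ B B₁ C C₁ - momentumRateB k A A₁ A₂ B B₁ B₂ C C₁ C₂

/-- The `C` component of the Euler-Lagrange expression. -/
def eulerLagrangeC : ℝ :=
  forceC c k A A₁ B B₁ C C₁ - momentumRateC k A A₁ A₂ B B₁ B₂ C C₁ C₂

end EulerLagrange

section PartialDerivatives

theorem deriv_quartic (c₀ c₁ c₂ c₃ c₄ x : ℝ) :
    deriv (fun y => c₀ + c₁ * y + c₂ * y ^ 2 + c₃ * y ^ 3 + c₄ * y ^ 4) x
      = c₁ + 2 * c₂ * x + 3 * c₃ * x ^ 2 + 4 * c₄ * x ^ 3 := by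
  have hi := hasDerivAt_id x
  have h := ((((hi.const_mul c₁).const_add c₀).add ((hi.pow 2).const_mul c₂)).add
    ((hi.pow 3).const_mul c₃)).add ((hi.pow 4).const_mul c₄)
  refine h.deriv.trans ?_
  simp only [id, Nat.cast_ofNat]
  ring

theorem hasDerivAt_laurent (c₁ d₁ d₂ d₃ : ℝ) {x : ℝ} (hx : x ≠ 0) :
    HasDerivAt (fun y => c₁ * y + d₁ / y + d₂ / y ^ 2 + d₃ / y ^ 3)
      (c₁ - d₁ / x ^ 2 - 2 * d₂ / x ^ 3 - 3 * d₃ / x ^ 4) x := by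
  have hi := hasDerivAt_id x
  refine ((((hi.const_mul c₁).add ((hasDerivAt_const x d₁).div hi hx)).add
    ((hasDerivAt_const x d₂).div (hi.pow 2) (pow_ne_zero 2 hx))).add
    ((hasDerivAt_const x d₃).div (hi.pow 3) (pow_ne_zero 3 hx))).congr_deriv ?_
  simp only [id, Nat.cast_ofNat, Pi.pow_apply]
  field_simp
  ring

variable {a c : ℝ} (ha : 0 < a) (hc : 2 * (Real.tanh a + (Real.tanh a)⁻¹) = c)
  (A A₁ B₁ C₁ : ℝ) {B C : ℝ} (hB : 0 < B) (hC : 0 < C)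
include ha hc hB hC

theorem deriv_effLagrangian_A :
    deriv (fun y => effLagrangian a y B C A₁ B₁ C₁) A
      = forceA c (cothTwo C) A A₁ B B₁ C C₁ := by
  simp only [effLagrangian_eq ha hc _ hB hC]
  generalize cothTwo C = k
  refine Eq.trans ?_ ((deriv_quartic (-(1 / 8) * A₁ ^ 2 * momentSq k C / B)
    (-(1 / 2) * (-(A₁ / 4 * (B₁ / B) * momentSq k C) + A₁ / 2 * C₁ * momentMix k C) / B)
    (-(1 / 2) * (1 / 4 * (B₁ / B) ^ 2 * momentDiff k C + 1 / 4 * C₁ ^ 2 * momentSum k C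
        - 4 / 3 * (B₁ / B) * C₁ * C) / B
      + B / 8 * (16 / 3 - momentSum k C) + 1 / 2 * momentSq k C / B)
    (-(c / 8 * momentCube k C) / B) (1 / 8 * momentQuartic k C / B) A).trans ?_)
  · congr 1; funext y; simp only [kineticForm, staticForm]; ring
  · rw [forceA]; ring

theorem deriv_effLagrangian_velocityA :
    deriv (fun y => effLagrangian a A B C y B₁ C₁) A₁
      = momentumA (cothTwo C) A A₁ B B₁ C C₁ := by
  simp only [effLagrangian_eq ha hc _ hB hC]
  generalize cothTwo C = k
  refine Eq.trans ?_ ((deriv_quartic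
    (-(1 / 2) * kineticForm k A B C 0 B₁ C₁ + staticForm c k A B C)
    (-(1 / 2) * (-(A / 4 * (B₁ / B) * momentSq k C) + A / 2 * C₁ * momentMix k C) / B)
    (-(1 / 8) * momentSq k C / B) 0 0 A₁).trans ?_)
  · congr 1; funext y; simp only [kineticForm]; ring
  · rw [momentumA]; ring

theorem deriv_effLagrangian_B :
    deriv (fun y => effLagrangian a A y C A₁ B₁ C₁) B
      = forceB c (cothTwo C) A A₁ B B₁ C C₁ := by
  generalize hk : cothTwo C = k
  have heff : (fun y => effLagrangian a A y C A₁ B₁ C₁) =ᶠ[nhds B] fun y =>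
      A ^ 2 / 8 * (16 / 3 - momentSum k C) * y
      + (-(1 / 2) * (A₁ ^ 2 / 4 * momentSq k C + A ^ 2 / 4 * C₁ ^ 2 * momentSum k C
          + A * A₁ / 2 * C₁ * momentMix k C)
        + (A ^ 4 / 8 * momentQuartic k C - c * A ^ 3 / 8 * momentCube k C
          + A ^ 2 / 2 * momentSq k C)) / y
      + 1 / 2 * (A * A₁ / 4 * B₁ * momentSq k C + 4 / 3 * A ^ 2 * B₁ * C₁ * C) / y ^ 2
      + -(1 / 8) * A ^ 2 * B₁ ^ 2 * momentDiff k C / y ^ 3 := by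
    filter_upwards [lt_mem_nhds hB] with y hy
    rw [effLagrangian_eq ha hc _ hy hC, hk, kineticForm, staticForm]
    ring
  refine heff.deriv_eq.trans ((hasDerivAt_laurent _ _ _ _ hB.ne').deriv.trans ?_)
  rw [forceB]
  ring

theorem deriv_effLagrangian_velocityB :
    deriv (fun y => effLagrangian a A B C A₁ y C₁) B₁
      = momentumB (cothTwo C) A A₁ B B₁ C C₁ := by
  simp only [effLagrangian_eq ha hc _ hB hC]
  generalize cothTwo C = k
  refine Eq.trans ?_ ((deriv_quartic
    (-(1 / 2) * kineticForm k A B C A₁ 0 C₁ + staticForm c k A B C)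
    (1 / 2 * (A * A₁ / 4 * momentSq k C + 4 / 3 * A ^ 2 * C₁ * C) / B ^ 2)
    (-(1 / 8) * A ^ 2 * momentDiff k C / B ^ 3) 0 0 B₁).trans ?_)
  · congr 1; funext y; simp only [kineticForm]; ring
  · rw [momentumB]; ring

theorem deriv_effLagrangian_C :
    deriv (fun y => effLagrangian a A B y A₁ B₁ C₁) C
      = forceC c (cothTwo C) A A₁ B B₁ C C₁ := by
  have heff : (fun y => effLagrangian a A B y A₁ B₁ C₁) =ᶠ[nhds C] fun y =>
      -(1 / 2) * kineticForm (cothTwo y) A B y A₁ B₁ C₁ + staticForm c (cothTwo y) A B y :=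
    (lt_mem_nhds hC).mono fun y hy => effLagrangian_eq ha hc A hB hy A₁ B₁ C₁
  have hSq := hasDerivAt_momentSq hC
  have hMix := hasDerivAt_momentMix hC
  have hSum := hasDerivAt_momentSum hC
  have hkin := ((((((hSq.const_mul (A₁ ^ 2 / 4)).add
    ((hasDerivAt_momentDiff hC).const_mul (A ^ 2 / 4 * (B₁ / B) ^ 2))).add
    (hSum.const_mul (A ^ 2 / 4 * C₁ ^ 2))).sub
    (hSq.const_mul (A * A₁ / 4 * (B₁ / B)))).add
    (hMix.const_mul (A * A₁ / 2 * C₁))).sub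
    ((hasDerivAt_id C).const_mul (4 / 3 * A ^ 2 * (B₁ / B) * C₁))).div_const B
  have hstat := ((hSum.const_sub (16 / 3)).const_mul (A ^ 2 * B / 8)).add
    (((((hasDerivAt_momentQuartic hC).const_mul (A ^ 4 / 8)).sub
    ((hasDerivAt_momentCube hC).const_mul (c * A ^ 3 / 8))).add
    (hSq.const_mul (A ^ 2 / 2))).div_const B)
  refine heff.deriv_eq.trans (((hkin.const_mul (-(1 / 2))).add hstat).deriv.trans ?_)
  rw [forceC]
  ring

theorem deriv_effLagrangian_velocityC :
    deriv (fun y => effLagrangian a A B C A₁ B₁ y) C₁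
      = momentumC (cothTwo C) A A₁ B B₁ C C₁ := by
  simp only [effLagrangian_eq ha hc _ hB hC]
  generalize cothTwo C = k
  refine Eq.trans ?_ ((deriv_quartic
    (-(1 / 2) * kineticForm k A B C A₁ B₁ 0 + staticForm c k A B C)
    (-(1 / 2) * (A * A₁ / 2 * momentMix k C / B - 4 / 3 * A ^ 2 * B₁ * C / B ^ 2))
    (-(1 / 8) * A ^ 2 * momentSum k C / B) 0 0 C₁).trans ?_)
  · congr 1; funext y; simp only [kineticForm]; ring
  · rw [momentumC]; ring

end PartialDerivatives

/-- The 2-jet of a curve at `t`: `f₁` is the derivative of `f` near `t`, and `f₂` is the second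
derivative of `f` at `t`. -/
def IsJet (f f₁ : ℝ → ℝ) (f₂ t : ℝ) : Prop :=
  (∀ᶠ s in nhds t, HasDerivAt f (f₁ s) s) ∧ HasDerivAt f₁ f₂ t

theorem IsJet.hasDerivAt {f f₁ : ℝ → ℝ} {f₂ t : ℝ} (h : IsJet f f₁ f₂ t) :
    HasDerivAt f (f₁ t) t := h.1.self_of_nhds

section Variation

variable {a c : ℝ} {A A₁ B B₁ C C₁ : ℝ → ℝ} {A₂ B₂ C₂ t : ℝ} (hA : IsJet A A₁ A₂ t)
  (hB : IsJet B B₁ B₂ t) (hC : IsJet C C₁ C₂ t) (hB0 : 0 < B t) (hC0 : 0 < C t)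
include hA hB hC hB0 hC0

theorem eventually_deriv_eq_and_pos : ∀ᶠ s in nhds t,
    deriv A s = A₁ s ∧ deriv B s = B₁ s ∧ deriv C s = C₁ s ∧ 0 < B s ∧ 0 < C s := by
  filter_upwards [hA.1, hB.1, hC.1, hB.hasDerivAt.continuousAt.eventually (lt_mem_nhds hB0),
    hC.hasDerivAt.continuousAt.eventually (lt_mem_nhds hC0)] with s hAs hBs hCs hBpos hCpos
  exact ⟨hAs.deriv, hBs.deriv, hCs.deriv, hBpos, hCpos⟩

theorem hasDerivAt_momentumA :
    HasDerivAt (fun s => momentumA (cothTwo (C s)) (A s) (A₁ s) (B s) (B₁ s) (C s) (C₁ s))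
      (momentumRateA (cothTwo (C t)) (A t) (A₁ t) A₂ (B t) (B₁ t) B₂ (C t) (C₁ t) C₂) t := by
  have hSq := (hasDerivAt_momentSq hC0).comp t hC.hasDerivAt
  have hMix := (hasDerivAt_momentMix hC0).comp t hC.hasDerivAt
  refine (((((hA.2.div_const 2).mul hSq).sub (((hA.hasDerivAt.div_const 4).mul
    (hB.2.div hB.hasDerivAt hB0.ne')).mul hSq)).add
    (((hA.hasDerivAt.div_const 2).mul hC.2).mul hMix)).div hB.hasDerivAt
    hB0.ne').const_mul (-(1 / 2)) |>.congr_deriv ?_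
  simp only [momentumRateA, Pi.mul_apply, Pi.sub_apply, Pi.add_apply, Pi.div_apply,
    Function.comp]
  field_simp
  ring

theorem hasDerivAt_momentumB :
    HasDerivAt (fun s => momentumB (cothTwo (C s)) (A s) (A₁ s) (B s) (B₁ s) (C s) (C₁ s))
      (momentumRateB (cothTwo (C t)) (A t) (A₁ t) A₂ (B t) (B₁ t) B₂ (C t) (C₁ t) C₂) t := by
  have hSq := (hasDerivAt_momentSq hC0).comp t hC.hasDerivAt
  have hDiff := (hasDerivAt_momentDiff hC0).comp t hC.hasDerivAt
  refine ((((((hA.hasDerivAt.pow 2).mul hB.2).div_const 2).mul hDiff).div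
    (hB.hasDerivAt.pow 3) (pow_ne_zero 3 hB0.ne')).sub
    (((((hA.hasDerivAt.mul hA.2).div_const 4).mul hSq).add
    ((((hA.hasDerivAt.pow 2).mul hC.2).mul hC.hasDerivAt).const_mul (4 / 3))).div
    (hB.hasDerivAt.pow 2) (pow_ne_zero 2 hB0.ne'))).const_mul (-(1 / 2)) |>.congr_deriv ?_
  simp only [momentumRateB, Pi.mul_apply, Pi.add_apply, Pi.pow_apply, Function.comp,
    Nat.cast_ofNat]
  field_simp
  ring

theorem hasDerivAt_momentumC :
    HasDerivAt (fun s => momentumC (cothTwo (C s)) (A s) (A₁ s) (B s) (B₁ s) (C s) (C₁ s))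
      (momentumRateC (cothTwo (C t)) (A t) (A₁ t) A₂ (B t) (B₁ t) B₂ (C t) (C₁ t) C₂) t := by
  have hMix := (hasDerivAt_momentMix hC0).comp t hC.hasDerivAt
  have hSum := (hasDerivAt_momentSum hC0).comp t hC.hasDerivAt
  refine (((((((hA.hasDerivAt.pow 2).mul hC.2).div_const 2).mul hSum).add
    (((hA.hasDerivAt.mul hA.2).div_const 2).mul hMix)).div hB.hasDerivAt hB0.ne').sub
    (((((hA.hasDerivAt.pow 2).mul hB.2).mul hC.hasDerivAt).const_mul (4 / 3)).div
    (hB.hasDerivAt.pow 2) (pow_ne_zero 2 hB0.ne'))).const_mul (-(1 / 2)) |>.congr_deriv ?_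
  simp only [momentumRateC, Pi.mul_apply, Pi.add_apply, Pi.pow_apply, Function.comp,
    Nat.cast_ofNat]
  field_simp
  ring

variable (ha : 0 < a) (hc : 2 * (Real.tanh a + (Real.tanh a)⁻¹) = c)
include ha hc

theorem variationA_eq :
    variationA a A B C t
      = eulerLagrangeA c (cothTwo (C t)) (A t) (A₁ t) A₂ (B t) (B₁ t) B₂ (C t) (C₁ t) C₂ := by
  have hmomentum : (fun s => deriv (fun y => effLagrangian a (A s) (B s) (C s) y
      (deriv B s) (deriv C s)) (deriv A s)) =ᶠ[nhds t] fun s =>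
        momentumA (cothTwo (C s)) (A s) (A₁ s) (B s) (B₁ s) (C s) (C₁ s) := by
    filter_upwards [eventually_deriv_eq_and_pos hA hB hC hB0 hC0]
      with s ⟨hAs, hBs, hCs, hBpos, hCpos⟩
    rw [hAs, hBs, hCs, deriv_effLagrangian_velocityA ha hc _ _ _ _ hBpos hCpos]
  rw [variationA, hmomentum.deriv_eq, (hasDerivAt_momentumA hA hB hC hB0 hC0).deriv,
    hA.hasDerivAt.deriv, hB.hasDerivAt.deriv, hC.hasDerivAt.deriv,
    deriv_effLagrangian_A ha hc _ _ _ _ hB0 hC0,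
    eulerLagrangeA]

theorem variationB_eq :
    variationB a A B C t
      = eulerLagrangeB c (cothTwo (C t)) (A t) (A₁ t) A₂ (B t) (B₁ t) B₂ (C t) (C₁ t) C₂ := by
  have hmomentum : (fun s => deriv (fun y => effLagrangian a (A s) (B s) (C s) (deriv A s)
      y (deriv C s)) (deriv B s)) =ᶠ[nhds t] fun s =>
        momentumB (cothTwo (C s)) (A s) (A₁ s) (B s) (B₁ s) (C s) (C₁ s) := by
    filter_upwards [eventually_deriv_eq_and_pos hA hB hC hB0 hC0]
      with s ⟨hAs, hBs, hCs, hBpos, hCpos⟩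
    rw [hAs, hBs, hCs, deriv_effLagrangian_velocityB ha hc _ _ _ _ hBpos hCpos]
  rw [variationB, hmomentum.deriv_eq, (hasDerivAt_momentumB hA hB hC hB0 hC0).deriv,
    hA.hasDerivAt.deriv, hB.hasDerivAt.deriv, hC.hasDerivAt.deriv,
    deriv_effLagrangian_B ha hc _ _ _ _ hB0 hC0,
    eulerLagrangeB]

theorem variationC_eq :
    variationC a A B C t
      = eulerLagrangeC c (cothTwo (C t)) (A t) (A₁ t) A₂ (B t) (B₁ t) B₂ (C t) (C₁ t) C₂ := by
  have hmomentum : (fun s => deriv (fun y => effLagrangian a (A s) (B s) (C s) (deriv A s)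
      (deriv B s) y) (deriv C s)) =ᶠ[nhds t] fun s =>
        momentumC (cothTwo (C s)) (A s) (A₁ s) (B s) (B₁ s) (C s) (C₁ s) := by
    filter_upwards [eventually_deriv_eq_and_pos hA hB hC hB0 hC0]
      with s ⟨hAs, hBs, hCs, hBpos, hCpos⟩
    rw [hAs, hBs, hCs, deriv_effLagrangian_velocityC ha hc _ _ _ _ hBpos hCpos]
  rw [variationC, hmomentum.deriv_eq, (hasDerivAt_momentumC hA hB hC hB0 hC0).deriv,
    hA.hasDerivAt.deriv, hB.hasDerivAt.deriv, hC.hasDerivAt.deriv,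
    deriv_effLagrangian_C ha hc _ _ _ _ hB0 hC0,
    eulerLagrangeC]

end Variation

/-! ### Exponentially small corrections -/

/-- Growth at most like a power of the argument; multiplication by such functions preserves
superpolynomial decay. -/
def Tame (f : ℝ → ℝ) : Prop := ∃ n : ℕ, f =O[atTop] fun t : ℝ => t ^ n

/-- Equality up to a superpolynomially small error, between functions of moderate growth. -/
structure Approx (f g : ℝ → ℝ) : Prop where
  left : Tame f
  right : Tame g
  decay : SuperpolynomialDecay atTop id fun t => f t - g t

namespace Tame

variable {f g : ℝ → ℝ}

theorem const (c : ℝ) : Tame fun _ => c :=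
  ⟨0, by simpa only [pow_zero] using isBigO_const_const c (one_ne_zero' ℝ) atTop⟩

theorem add (hf : Tame f) (hg : Tame g) : Tame fun t => f t + g t := by
  obtain ⟨m, hm⟩ := hf
  obtain ⟨n, hn⟩ := hg
  exact ⟨max m n, (hm.trans (IsBigO.pow_of_le_right (eventually_ge_atTop 1) (le_max_left m n))).add
    (hn.trans (IsBigO.pow_of_le_right (eventually_ge_atTop 1) (le_max_right m n)))⟩

theorem mul (hf : Tame f) (hg : Tame g) : Tame fun t => f t * g t := by
  obtain ⟨m, hm⟩ := hf
  obtain ⟨n, hn⟩ := hg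
  exact ⟨m + n, by simpa only [pow_add] using hm.mul hn⟩

theorem pow (hf : Tame f) (k : ℕ) : Tame fun t => f t ^ k := by
  obtain ⟨m, hm⟩ := hf
  exact ⟨m * k, by simpa only [pow_mul] using hm.pow k⟩

theorem inv_pow (hf : Tame fun t => (f t)⁻¹) (k : ℕ) : Tame fun t => (f t ^ k)⁻¹ := by
  simpa only [_root_.inv_pow] using hf.pow k

theorem mul_decay (hf : Tame f) (hg : SuperpolynomialDecay atTop id g) :
    SuperpolynomialDecay atTop id fun t => f t * g t := by
  obtain ⟨m, hm⟩ := hf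
  intro n
  refine IsBigO.trans_tendsto ?_ (hg (n + m))
  refine ((isBigO_refl (fun t : ℝ => t ^ n) atTop).mul
    (hm.mul (isBigO_refl g atTop))).congr_right fun t => ?_
  rw [pow_add, mul_assoc, id]

theorem of_decay (hf : SuperpolynomialDecay atTop id f) : Tame f :=
  ⟨0, by simpa using (superpolynomialDecay_iff_isBigO f tendsto_id).1 hf 0⟩

end Tame

namespace Approx

variable {f f' g g' : ℝ → ℝ}

theorem refl (hf : Tame f) : Approx f f :=
  ⟨hf, hf, (superpolynomialDecay_zero atTop id).congr fun t => (sub_self (f t)).symm⟩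

theorem const (c : ℝ) : Approx (fun _ => c) fun _ => c := .refl (.const c)

theorem add (hf : Approx f f') (hg : Approx g g') :
    Approx (fun t => f t + g t) fun t => f' t + g' t :=
  ⟨hf.left.add hg.left, hf.right.add hg.right,
    (hf.decay.add hg.decay).congr fun t => by simp only [Pi.add_apply]; ring⟩

theorem mul (hf : Approx f f') (hg : Approx g g') :
    Approx (fun t => f t * g t) fun t => f' t * g' t :=
  ⟨hf.left.mul hg.left, hf.right.mul hg.right,
    ((hf.left.mul_decay hg.decay).add (hg.right.mul_decay hf.decay)).congr fun t => by
      simp only [Pi.add_apply]; ring⟩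

theorem neg (hf : Approx f f') : Approx (fun t => -f t) fun t => -f' t := by
  simpa only [neg_one_mul] using (const (-1)).mul hf

theorem sub (hf : Approx f f') (hg : Approx g g') :
    Approx (fun t => f t - g t) fun t => f' t - g' t := by
  simpa only [sub_eq_add_neg] using hf.add hg.neg

theorem pow (hf : Approx f f') (k : ℕ) : Approx (fun t => f t ^ k) fun t => f' t ^ k := by
  induction k with
  | zero => simpa only [pow_zero] using const 1
  | succ k ih => simpa only [pow_succ] using ih.mul hf

theorem div (hf : Approx f f') (hg : Tame fun t => (g t)⁻¹) :
    Approx (fun t => f t / g t) fun t => f' t / g t := by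
  simpa only [div_eq_mul_inv] using hf.mul (refl hg)

theorem isBigO_inv_pow (h : Approx f g) {n : ℕ} (hg : g =O[atTop] fun t : ℝ => (t ^ n)⁻¹) :
    f =O[atTop] fun t : ℝ => (t ^ n)⁻¹ := by
  have hdecay := (superpolynomialDecay_iff_isBigO _ tendsto_id).1 h.decay (-n)
  simpa using (hdecay.congr_right fun t => by simp).add hg

end Approx

theorem cothTwo_sub_one_bounds {C : ℝ} (hC : 1 ≤ C) :
    0 ≤ cothTwo C - 1 ∧ cothTwo C - 1 ≤ 4 * Real.exp (-C) := by
  have htanh : 0 < Real.tanh (2 * C) := tanh_pos (by linarith)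
  have hlt := Real.tanh_lt_one (2 * C)
  have hexp : Real.exp (-(2 * (2 * C))) ≤ 1 / 4 := by
    rw [Real.exp_neg, one_div, inv_le_inv₀ (Real.exp_pos _) (by norm_num)]
    linarith [Real.add_one_le_exp (2 * (2 * C))]
  have hgap : 1 - Real.tanh (2 * C) ≤ 2 * Real.exp (-(2 * (2 * C))) := by
    rw [one_sub_tanh_eq]
    exact div_le_self (by positivity) (by linarith [Real.exp_pos (-(2 * (2 * C)))])
  have hmono : Real.exp (-(2 * (2 * C))) ≤ Real.exp (-C) := Real.exp_le_exp.2 (by linarith)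
  have heq : cothTwo C - 1 = (1 - Real.tanh (2 * C)) / Real.tanh (2 * C) := by
    rw [cothTwo]; field_simp
  rw [heq]
  refine ⟨div_nonneg (by linarith) htanh.le, ?_⟩
  rw [div_le_iff₀ htanh]
  nlinarith [Real.exp_pos (-C)]

theorem approx_cothTwo {C : ℝ → ℝ} (hC : ∀ᶠ t in atTop, t ≤ C t) :
    Approx (fun t => cothTwo (C t)) fun _ => 1 := by
  have hexp : SuperpolynomialDecay atTop id fun t : ℝ => Real.exp (-t) :=
    Real.tendsto_pow_mul_exp_neg_atTop_nhds_zero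
  have hdecay : SuperpolynomialDecay atTop id fun t => cothTwo (C t) - 1 := by
    refine (hexp.const_mul 4).trans_eventually_abs_le ?_
    filter_upwards [hC, eventually_ge_atTop 1] with t ht ht1
    obtain ⟨h0, h⟩ := cothTwo_sub_one_bounds (ht1.trans ht)
    simp only [Function.comp, abs_of_nonneg h0, abs_of_nonneg (by positivity :
      (0 : ℝ) ≤ 4 * Real.exp (-t))]
    exact h.trans (by gcongr)
  refine ⟨?_, .const 1, hdecay⟩
  simpa only [sub_add_cancel] using (Tame.of_decay hdecay).add (.const 1)

/-! ### The Euler-Lagrange expressions up to exponentially small corrections -/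

/-- `f₁`, `f₂` are the first two derivatives of `f` for large arguments, and all are tame. -/
structure TameJet (f f₁ f₂ : ℝ → ℝ) : Prop where
  jet : ∀ᶠ t in atTop, IsJet f f₁ (f₂ t) t
  tame₀ : Tame f
  tame₁ : Tame f₁
  tame₂ : Tame f₂

theorem TameJet.mul {f f₁ f₂ g g₁ g₂ : ℝ → ℝ} (hf : TameJet f f₁ f₂) (hg : TameJet g g₁ g₂) :
    TameJet (fun t => f t * g t) (fun t => f₁ t * g t + f t * g₁ t)
      (fun t => f₂ t * g t + 2 * f₁ t * g₁ t + f t * g₂ t) where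
  jet := by
    filter_upwards [hf.jet, hg.jet] with t hft hgt
    refine ⟨?_, ?_⟩
    · filter_upwards [hft.1, hgt.1] with s hfs hgs
      exact hfs.mul hgs
    · refine ((hft.2.mul hgt.hasDerivAt).add (hft.hasDerivAt.mul hgt.2)).congr_deriv ?_
      ring
  tame₀ := hf.tame₀.mul hg.tame₀
  tame₁ := (hf.tame₁.mul hg.tame₀).add (hf.tame₀.mul hg.tame₁)
  tame₂ := ((hf.tame₂.mul hg.tame₀).add (((Tame.const 2).mul hf.tame₁).mul hg.tame₁)).add
    (hf.tame₀.mul hg.tame₂)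

section Approximation

variable {A A₁ A₂ B B₁ B₂ C C₁ C₂ k : ℝ → ℝ} (hA : TameJet A A₁ A₂) (hB : TameJet B B₁ B₂)
  (hC : TameJet C C₁ C₂) (hBinv : Tame fun t => (B t)⁻¹) (hk : Approx k fun _ => 1)
include hA hB hC hBinv hk

theorem approx_eulerLagrangeA (c : ℝ) : Approx
    (fun t => eulerLagrangeA c (k t) (A t) (A₁ t) (A₂ t) (B t) (B₁ t) (B₂ t) (C t) (C₁ t) (C₂ t))
    fun t => eulerLagrangeA c 1 (A t) (A₁ t) (A₂ t) (B t) (B₁ t) (B₂ t) (C t) (C₁ t) (C₂ t) := by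
  obtain ⟨-, hA₀, hA₁, hA₂⟩ := hA
  obtain ⟨-, hB₀, hB₁, hB₂⟩ := hB
  obtain ⟨-, hC₀, hC₁, hC₂⟩ := hC
  simp only [eulerLagrangeA, forceA, momentumRateA, momentSq, momentMix, momentTwo, momentTwoSq,
    momentSum, momentDiff, momentCube, momentQuartic]
  apply_rules (maxDepth := 5000) (transparency := .reducible) [Approx.const, Approx.add,
    Approx.sub, Approx.neg, Approx.mul, Approx.pow, Approx.div, Approx.refl, Tame.const,
    Tame.inv_pow]

theorem approx_eulerLagrangeB (c : ℝ) : Approx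
    (fun t => eulerLagrangeB c (k t) (A t) (A₁ t) (A₂ t) (B t) (B₁ t) (B₂ t) (C t) (C₁ t) (C₂ t))
    fun t => eulerLagrangeB c 1 (A t) (A₁ t) (A₂ t) (B t) (B₁ t) (B₂ t) (C t) (C₁ t) (C₂ t) := by
  obtain ⟨-, hA₀, hA₁, hA₂⟩ := hA
  obtain ⟨-, -, hB₁, hB₂⟩ := hB
  obtain ⟨-, hC₀, hC₁, hC₂⟩ := hC
  simp only [eulerLagrangeB, forceB, momentumRateB, momentSq, momentMix, momentTwo, momentTwoSq,
    momentTwoSqDeriv, momentSum, momentDiff, momentCube, momentQuartic, momentDiffDeriv]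
  apply_rules (maxDepth := 5000) (transparency := .reducible) [Approx.const, Approx.add,
    Approx.sub, Approx.neg, Approx.mul, Approx.pow, Approx.div, Approx.refl, Tame.const,
    Tame.inv_pow]

theorem approx_eulerLagrangeC (c : ℝ) : Approx
    (fun t => eulerLagrangeC c (k t) (A t) (A₁ t) (A₂ t) (B t) (B₁ t) (B₂ t) (C t) (C₁ t) (C₂ t))
    fun t => eulerLagrangeC c 1 (A t) (A₁ t) (A₂ t) (B t) (B₁ t) (B₂ t) (C t) (C₁ t) (C₂ t) := by
  obtain ⟨-, hA₀, hA₁, hA₂⟩ := hA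
  obtain ⟨-, hB₀, hB₁, hB₂⟩ := hB
  obtain ⟨-, hC₀, hC₁, hC₂⟩ := hC
  simp only [eulerLagrangeC, forceC, momentumRateC, momentSq, momentMix, momentTwo, momentTwoSq,
    momentTwoSqDeriv, momentSum, momentCube, momentDiffDeriv, momentQuarticDeriv]
  apply_rules (maxDepth := 5000) (transparency := .reducible) [Approx.const, Approx.add,
    Approx.sub, Approx.neg, Approx.mul, Approx.pow, Approx.div, Approx.refl, Tame.const,
    Tame.inv_pow]

theorem approx_energy (c : ℝ) : Approx
    (fun t => 1 / 2 * kineticForm (k t) (A t) (B t) (C t) (A₁ t) (B₁ t) (C₁ t)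
      + staticForm c (k t) (A t) (B t) (C t))
    fun t => 1 / 2 * kineticForm 1 (A t) (B t) (C t) (A₁ t) (B₁ t) (C₁ t)
      + staticForm c 1 (A t) (B t) (C t) := by
  obtain ⟨-, hA₀, hA₁, -⟩ := hA
  obtain ⟨-, hB₀, hB₁, -⟩ := hB
  obtain ⟨-, hC₀, hC₁, -⟩ := hC
  simp only [kineticForm, staticForm, momentSq, momentMix, momentTwo, momentTwoSq, momentSum,
    momentDiff, momentCube, momentQuartic]
  apply_rules (maxDepth := 5000) (transparency := .reducible) [Approx.const, Approx.add,
    Approx.sub, Approx.neg, Approx.mul, Approx.pow, Approx.div, Approx.refl, Tame.const,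
    Tame.inv_pow]

end Approximation

/-- `δS/δA` without exponentially small terms, in terms of `X = C / B`. -/
def limA (b A A₁ A₂ B B₁ B₂ X X₁ X₂ : ℝ) : ℝ :=
  2 / 3 * A * B * (1 - X₁ ^ 2) + 2 * X * (8 * A ^ 3 - (8 / b + 4 * b) * A ^ 2 + 4 * A)
    - (44 / 3 * A ^ 3 - (12 / b + 6 * b) * A ^ 2 + 4 * A) / B
    - ((Real.pi ^ 2 / 9 - 2 / 3) / 2 + 1) * A * B₁ ^ 2 / B ^ 3 + A₁ * B₁ / B ^ 2 + 2 * A₁ * X₁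
    + A₂ * (2 * X - 1 / B) + A * B₂ / (2 * B ^ 2) + A * X₂

/-- `δS/δB` at fixed `X`, without exponentially small terms. -/
def limB (b A A₁ A₂ B B₁ B₂ X₁ : ℝ) : ℝ :=
  A ^ 2 / 3 * (1 - X₁ ^ 2)
    + (11 / 3 * A ^ 4 - (4 / b + 2 * b) * A ^ 3 + 2 * A ^ 2 + A * A₂ / 2) / B ^ 2
    - 3 / 4 * (Real.pi ^ 2 / 9 - 2 / 3) * A ^ 2 * B₁ ^ 2 / B ^ 4
    + (Real.pi ^ 2 / 9 - 2 / 3) * (A ^ 2 * B₂ / 2 + A * A₁ * B₁) / B ^ 3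

/-- `δS/δX` at fixed `B`, without exponentially small terms. -/
def limX (b A A₁ A₂ B B₁ X₁ X₂ : ℝ) : ℝ :=
  2 * (2 * A ^ 4 - 4 / 3 * (2 / b + b) * A ^ 3 + 2 * A ^ 2)
    + 2 / 3 * (2 * A * A₁ * B * X₁ + A ^ 2 * B₁ * X₁ + A ^ 2 * B * X₂) + A * A₂

/-- The energy without exponentially small terms. -/
def limEnergy (b A A₁ B B₁ X X₁ : ℝ) : ℝ :=
  1 / 2 * (A₁ ^ 2 * (2 * X - 1 / B) + (Real.pi ^ 2 / 9 - 2 / 3) / 2 * A ^ 2 * B₁ ^ 2 / B ^ 3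
      + 2 / 3 * A ^ 2 * B * X₁ ^ 2 + A * A₁ * B₁ / B ^ 2 + 2 * A * A₁ * X₁)
    + A ^ 2 * B / 3 + 2 * X * (2 * A ^ 4 - 4 / 3 * (2 / b + b) * A ^ 3 + 2 * A ^ 2)
    - (11 / 3 * A ^ 4 - (4 / b + 2 * b) * A ^ 3 + 2 * A ^ 2) / B

section Limit

variable {b B : ℝ} (hb : b ≠ 0) (hB : B ≠ 0) (A A₁ A₂ B₁ B₂ X X₁ X₂ : ℝ)
include hb hB

theorem eulerLagrangeA_one :
    eulerLagrangeA (4 * (2 + b ^ 2) / (3 * b)) 1 A A₁ A₂ B B₁ B₂ (B * X) (B₁ * X + B * X₁)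
      (B₂ * X + 2 * B₁ * X₁ + B * X₂) = limA b A A₁ A₂ B B₁ B₂ X X₁ X₂ := by
  simp only [eulerLagrangeA, forceA, momentumRateA, momentSq, momentMix, momentTwo, momentTwoSq,
    momentSum, momentDiff, momentCube, momentQuartic, limA]
  field_simp
  ring

theorem eulerLagrangeB_one :
    eulerLagrangeB (4 * (2 + b ^ 2) / (3 * b)) 1 A A₁ A₂ B B₁ B₂ (B * X) (B₁ * X + B * X₁)
        (B₂ * X + 2 * B₁ * X₁ + B * X₂)
      = limB b A A₁ A₂ B B₁ B₂ X₁ - X / B * limX b A A₁ A₂ B B₁ X₁ X₂ := by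
  simp only [eulerLagrangeB, forceB, momentumRateB, momentSq, momentMix, momentTwo, momentTwoSq,
    momentTwoSqDeriv, momentSum, momentDiff, momentCube, momentQuartic, momentDiffDeriv, limB, limX]
  field_simp
  ring

theorem eulerLagrangeC_one :
    eulerLagrangeC (4 * (2 + b ^ 2) / (3 * b)) 1 A A₁ A₂ B B₁ B₂ (B * X) (B₁ * X + B * X₁)
      (B₂ * X + 2 * B₁ * X₁ + B * X₂) = limX b A A₁ A₂ B B₁ X₁ X₂ / B := by
  simp only [eulerLagrangeC, forceC, momentumRateC, momentSq, momentMix, momentTwo, momentTwoSq,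
    momentTwoSqDeriv, momentSum, momentCube, momentDiffDeriv, momentQuarticDeriv, limX]
  field_simp
  ring

theorem energy_one :
    1 / 2 * kineticForm 1 A B (B * X) A₁ B₁ (B₁ * X + B * X₁)
      + staticForm (4 * (2 + b ^ 2) / (3 * b)) 1 A B (B * X) = limEnergy b A A₁ B B₁ X X₁ := by
  simp only [kineticForm, staticForm, momentSq, momentMix, momentTwo, momentTwoSq, momentSum,
    momentDiff, momentCube, momentQuartic, limEnergy]
  field_simp
  ring

end Limit

/-- A curve `(A, B, X)` with tame jets along which the width `C = B X` of the profile grows at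
least linearly, so that `coth (2 C) - 1` is exponentially small. -/
structure WideCurve (A A₁ A₂ B B₁ B₂ X X₁ X₂ : ℝ → ℝ) : Prop where
  jetA : TameJet A A₁ A₂
  jetB : TameJet B B₁ B₂
  jetX : TameJet X X₁ X₂
  tame_inv : Tame fun t => (B t)⁻¹
  pos : ∀ᶠ t in atTop, 0 < B t ∧ 0 < X t
  le : ∀ᶠ t in atTop, t ≤ B t * X t

namespace WideCurve

variable {a b : ℝ} {A A₁ A₂ B B₁ B₂ X X₁ X₂ : ℝ → ℝ} (w : WideCurve A A₁ A₂ B B₁ B₂ X X₁ X₂)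
  (ha : 0 < a) (hb : 0 < b) (hab : Real.tanh (2 * a) = 3 * b / (2 + b ^ 2)) {n : ℕ}
include w ha hb hab

theorem variationA_isBigO
    (hlim : (fun t => limA b (A t) (A₁ t) (A₂ t) (B t) (B₁ t) (B₂ t) (X t) (X₁ t) (X₂ t))
      =O[atTop] fun t : ℝ => (t ^ n)⁻¹) :
    variationA a A B (fun t => B t * X t) =O[atTop] fun t : ℝ => (t ^ n)⁻¹ := by
  have hC := w.jetB.mul w.jetX
  have happrox := approx_eulerLagrangeA w.jetA w.jetB hC w.tame_inv (approx_cothTwo w.le)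
    (4 * (2 + b ^ 2) / (3 * b))
  refine EventuallyEq.trans_isBigO ?_
    (happrox.isBigO_inv_pow (EventuallyEq.trans_isBigO ?_ hlim))
  · filter_upwards [w.jetA.jet, w.jetB.jet, hC.jet, w.pos] with t hAt hBt hCt hpos
    have heq := variationA_eq hAt hBt hCt hpos.1 (mul_pos hpos.1 hpos.2) ha
      (tanh_add_inv_tanh ha hab hb)
    exact heq
  · filter_upwards [w.pos] with t hpos
    exact eulerLagrangeA_one hb.ne' hpos.1.ne' _ _ _ _ _ _ _ _

theorem variationB_isBigO
    (hlim : (fun t => limB b (A t) (A₁ t) (A₂ t) (B t) (B₁ t) (B₂ t) (X₁ t)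
        - X t / B t * limX b (A t) (A₁ t) (A₂ t) (B t) (B₁ t) (X₁ t) (X₂ t))
      =O[atTop] fun t : ℝ => (t ^ n)⁻¹) :
    variationB a A B (fun t => B t * X t) =O[atTop] fun t : ℝ => (t ^ n)⁻¹ := by
  have hC := w.jetB.mul w.jetX
  have happrox := approx_eulerLagrangeB w.jetA w.jetB hC w.tame_inv (approx_cothTwo w.le)
    (4 * (2 + b ^ 2) / (3 * b))
  refine EventuallyEq.trans_isBigO ?_
    (happrox.isBigO_inv_pow (EventuallyEq.trans_isBigO ?_ hlim))
  · filter_upwards [w.jetA.jet, w.jetB.jet, hC.jet, w.pos] with t hAt hBt hCt hpos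
    have heq := variationB_eq hAt hBt hCt hpos.1 (mul_pos hpos.1 hpos.2) ha
      (tanh_add_inv_tanh ha hab hb)
    exact heq
  · filter_upwards [w.pos] with t hpos
    exact eulerLagrangeB_one hb.ne' hpos.1.ne' _ _ _ _ _ _ _ _

theorem variationC_isBigO
    (hlim : (fun t => limX b (A t) (A₁ t) (A₂ t) (B t) (B₁ t) (X₁ t) (X₂ t) / B t)
      =O[atTop] fun t : ℝ => (t ^ n)⁻¹) :
    variationC a A B (fun t => B t * X t) =O[atTop] fun t : ℝ => (t ^ n)⁻¹ := by
  have hC := w.jetB.mul w.jetX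
  have happrox := approx_eulerLagrangeC w.jetA w.jetB hC w.tame_inv (approx_cothTwo w.le)
    (4 * (2 + b ^ 2) / (3 * b))
  refine EventuallyEq.trans_isBigO ?_
    (happrox.isBigO_inv_pow (EventuallyEq.trans_isBigO ?_ hlim))
  · filter_upwards [w.jetA.jet, w.jetB.jet, hC.jet, w.pos] with t hAt hBt hCt hpos
    have heq := variationC_eq hAt hBt hCt hpos.1 (mul_pos hpos.1 hpos.2) ha
      (tanh_add_inv_tanh ha hab hb)
    exact heq
  · filter_upwards [w.pos] with t hpos
    exact eulerLagrangeC_one hb.ne' hpos.1.ne' _ _ _ _ _ _ _ _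

theorem energy_isBigO {e : ℝ}
    (hlim : (fun t => limEnergy b (A t) (A₁ t) (B t) (B₁ t) (X t) (X₁ t) - e)
      =O[atTop] fun t : ℝ => (t ^ n)⁻¹) :
    (fun t => fieldEnergy a (lump A B X) t - e) =O[atTop] fun t : ℝ => (t ^ n)⁻¹ := by
  have happrox := (approx_energy w.jetA w.jetB (w.jetB.mul w.jetX) w.tame_inv
    (approx_cothTwo w.le) (4 * (2 + b ^ 2) / (3 * b))).sub (.const e)
  refine EventuallyEq.trans_isBigO ?_
    (happrox.isBigO_inv_pow (EventuallyEq.trans_isBigO ?_ hlim))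
  · filter_upwards [w.jetA.jet, w.jetB.jet, w.jetX.jet, w.pos] with t hAt hBt hXt hpos
    exact congrArg (· - e) (fieldEnergy_eq ha (tanh_add_inv_tanh ha hab hb) hAt.hasDerivAt
      hBt.hasDerivAt hXt.hasDerivAt hpos.1 hpos.2)
  · filter_upwards [w.pos] with t hpos
    rw [energy_one hb.ne' hpos.1.ne']

end WideCurve

/-! ### The equations for asymptotic expansions -/

/-- Asymptotic expansions of `(A, B, X)` in the inverse time `z`, with values in a commutative ring:
`X = z⁻¹ (1 + z² x)`, `B = z⁻¹ (2 (r² - 1) + z β₀ + z² y)` and `A = r + z² a`, where `r` stands for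
`1 / b` and `m` for `π² / 9 - 2 / 3`. Each `n`th term of the series `x₁`, `y₁`, `a₁` and `x₂`, `y₂`,
`a₂` carries the weight that the first or second time derivative produces. -/
structure Expansion (R : Type*) where
  (z b r m β₀ x x₁ x₂ y y₁ y₂ a a₁ a₂ : R)

namespace Expansion

section Ring

variable {R R' : Type*} [CommRing R] [CommRing R']

/-- The image of an expansion under a ring homomorphism. -/
def map (F : R →+* R') (e : Expansion R) : Expansion R' :=
  ⟨F e.z, F e.b, F e.r, F e.m, F e.β₀, F e.x, F e.x₁, F e.x₂, F e.y, F e.y₁, F e.y₂, F e.a, F e.a₁,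
    F e.a₂⟩

variable (e : Expansion R)

/-- The coordinate `A`. -/
def height : R := e.r + e.z ^ 2 * e.a

/-- The time derivative of `A`. -/
def height₁ : R := -(e.z ^ 3 * e.a₁)

/-- The second time derivative of `A`. -/
def height₂ : R := e.z ^ 4 * e.a₂

/-- The rescaled coordinate `z B`. -/
def slope : R := 2 * (e.r ^ 2 - 1) + e.z * e.β₀ + e.z ^ 2 * e.y

/-- The time derivative of `B`. -/
def slope₁ : R := 2 * (e.r ^ 2 - 1) - e.z ^ 2 * e.y₁

/-- The second time derivative of `B`. -/
def slope₂ : R := e.z ^ 3 * e.y₂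

/-- The rescaled coordinate `z X`. -/
def place : R := 1 + e.z ^ 2 * e.x

/-- The time derivative of `X`. -/
def place₁ : R := 1 - e.z ^ 2 * e.x₁

/-- The second time derivative of `X`. -/
def place₂ : R := e.z ^ 3 * e.x₂

/-- The left-hand side `limA` of `δS/δA = 0`, divided by its leading power of `z` and cleared of
denominators. -/
def residualA : R :=
  4 * e.height * e.slope ^ 4 * (1 + e.place₁) * e.x₁
    + 48 * e.place * e.height * (2 * e.height - e.b) * e.slope ^ 3 * e.a
    - 2 * (44 * e.height ^ 3 - (36 * e.r + 18 * e.b) * e.height ^ 2 + 12 * e.height) * e.slope ^ 2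
    - (3 * e.m + 6) * e.z ^ 2 * e.height * e.slope₁ ^ 2 + 6 * e.z * e.height₁ * e.slope₁ * e.slope
    - 12 * e.z ^ 2 * e.a₁ * e.place₁ * e.slope ^ 3 + 12 * e.z ^ 2 * e.a₂ * e.place * e.slope ^ 3
    - 6 * e.height₂ * e.slope ^ 2 + 3 * e.z * e.height * e.slope₂ * e.slope
    + 6 * e.z ^ 2 * e.x₂ * e.height * e.slope ^ 3

/-- The left-hand side `limB` of `δS/δB = 0` at fixed `X`, divided by its leading power of `z` and
cleared of denominators. -/
def residualB : R :=
  4 * e.height ^ 2 * e.slope ^ 4 * (1 + e.place₁) * e.x₁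
    + (4 * (11 * e.height ^ 4 - (12 * e.r + 6 * e.b) * e.height ^ 3 + 6 * e.height ^ 2)
      + 6 * e.height * e.height₂) * e.slope ^ 2
    - 9 * e.m * e.z ^ 2 * e.height ^ 2 * e.slope₁ ^ 2
    + e.z * (6 * e.m * e.height ^ 2 * e.slope₂ + 12 * e.m * e.height * e.height₁ * e.slope₁)
      * e.slope

/-- The left-hand side `limX` of `δS/δX = 0` at fixed `B`, divided by `A` and its leading power of
`z` and cleared of denominators. -/
def residualX : R :=
  4 * e.height * e.a * (3 * e.height - e.r - 2 * e.b) - 4 * e.a₁ * e.slope * e.place₁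
    - 2 * e.height * (e.y₁ * e.place₁ + 2 * (e.r ^ 2 - 1) * e.x₁)
    + 2 * e.height * e.slope * e.x₂ + 3 * e.z ^ 2 * e.a₂

theorem map_residualA (F : R →+* R') : F e.residualA = (e.map F).residualA := by
  simp only [residualA, height, height₁, height₂, slope, slope₁, slope₂, place, place₁, map,
    map_add, map_sub, map_neg, map_mul, map_pow, map_ofNat, map_one]

theorem map_residualB (F : R →+* R') : F e.residualB = (e.map F).residualB := by
  simp only [residualB, height, height₁, height₂, slope, slope₁, slope₂, place₁, map, map_add,
    map_sub, map_neg, map_mul, map_pow, map_ofNat, map_one]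

theorem map_residualX (F : R →+* R') : F e.residualX = (e.map F).residualX := by
  simp only [residualX, height, slope, place₁, map, map_add, map_sub, map_mul, map_pow, map_ofNat,
    map_one]

/-- The expansion with all nine series multiplied by `z`. -/
def shift : Expansion R :=
  ⟨e.z, e.b, e.r, e.m, e.β₀, e.z * e.x, e.z * e.x₁, e.z * e.x₂, e.z * e.y, e.z * e.y₁, e.z * e.y₂,
    e.z * e.a, e.z * e.a₁, e.z * e.a₂⟩

variable {e} {e' : Expansion R}

theorem coordinates_eq_of_shift_eq (h : e.shift = e'.shift) :
    (e.height = e'.height ∧ e.height₁ = e'.height₁ ∧ e.height₂ = e'.height₂) ∧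
    (e.slope = e'.slope ∧ e.slope₁ = e'.slope₁ ∧ e.slope₂ = e'.slope₂) ∧
    (e.place = e'.place ∧ e.place₁ = e'.place₁) := by
  simp only [shift, mk.injEq] at h
  obtain ⟨hz, -, hr, -, hβ₀, hx, hx₁, -, hy, hy₁, hy₂, ha, ha₁, ha₂⟩ := h
  rw [← hz] at hx hx₁ hy hy₁ hy₂ ha ha₁ ha₂
  simp only [height, height₁, height₂, slope, slope₁, slope₂, place, place₁, ← hz, ← hr, ← hβ₀]
  refine ⟨⟨?_, ?_, ?_⟩, ⟨?_, ?_, ?_⟩, ?_, ?_⟩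
  · linear_combination e.z * ha
  · linear_combination -e.z ^ 2 * ha₁
  · linear_combination e.z ^ 3 * ha₂
  · linear_combination e.z * hy
  · linear_combination -e.z * hy₁
  · linear_combination e.z ^ 2 * hy₂
  · linear_combination e.z * hx
  · linear_combination -e.z * hx₁

theorem residualB_sub (h : e.shift = e'.shift) :
    e.residualB - e'.residualB
      = 4 * e.height ^ 2 * e.slope ^ 4 * (1 + e.place₁) * (e.x₁ - e'.x₁) := by
  obtain ⟨⟨hA, hA₁, hA₂⟩, ⟨hB, hB₁, hB₂⟩, -, hX₁⟩ := coordinates_eq_of_shift_eq h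
  simp only [shift, mk.injEq] at h
  obtain ⟨hz, hb, hr, hm, -⟩ := h
  simp only [residualB, ← hA, ← hA₁, ← hA₂, ← hB, ← hB₁, ← hB₂, ← hX₁, ← hz, ← hb, ← hr, ← hm]
  ring

theorem residualA_sub (h : e.shift = e'.shift) :
    e.residualA - e'.residualA
      = 4 * e.height * e.slope ^ 4 * (1 + e.place₁) * (e.x₁ - e'.x₁)
        + 48 * e.place * e.height * (2 * e.height - e.b) * e.slope ^ 3 * (e.a - e'.a) := by
  obtain ⟨⟨hA, hA₁, hA₂⟩, ⟨hB, hB₁, hB₂⟩, hX, hX₁⟩ := coordinates_eq_of_shift_eq h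
  simp only [shift, mk.injEq] at h
  obtain ⟨hz, hb, hr, hm, -, -, -, hx₂, -, -, -, -, ha₁, ha₂⟩ := h
  rw [← hz] at hx₂ ha₁ ha₂
  simp only [residualA, ← hA, ← hA₁, ← hA₂, ← hB, ← hB₁, ← hB₂, ← hX, ← hX₁, ← hz, ← hb, ← hr,
    ← hm]
  linear_combination -12 * e.z * e.place₁ * e.slope ^ 3 * ha₁
    + 12 * e.z * e.place * e.slope ^ 3 * ha₂ + 6 * e.z * e.height * e.slope ^ 3 * hx₂

theorem residualX_sub (h : e.shift = e'.shift) :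
    e.residualX - e'.residualX
      = 4 * e.height * (3 * e.height - e.r - 2 * e.b) * (e.a - e'.a)
        + -4 * e.slope * e.place₁ * (e.a₁ - e'.a₁) + -2 * e.height * e.place₁ * (e.y₁ - e'.y₁)
        + -4 * e.height * (e.r ^ 2 - 1) * (e.x₁ - e'.x₁)
        + 2 * e.height * e.slope * (e.x₂ - e'.x₂) := by
  obtain ⟨⟨hA, -, -⟩, ⟨hB, -, -⟩, -, hX₁⟩ := coordinates_eq_of_shift_eq h
  simp only [shift, mk.injEq] at h
  obtain ⟨hz, hb, hr, -, -, -, -, -, -, -, -, -, -, ha₂⟩ := h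
  rw [← hz] at ha₂
  simp only [residualX, ← hA, ← hB, ← hX₁, ← hz, ← hb, ← hr]
  linear_combination 3 * e.z * ha₂

end Ring

end Expansion

/-- Differentiating `∑ u n t⁻¹ ^ (n + k)` multiplies its `n`th coefficient by this weight, up to
sign. -/
def weighted (k : ℕ) (u : ℕ → ℝ) (n : ℕ) : ℝ := (n + k) * u n

/-- The expansion with coefficient sequences `ξ`, `β`, `α`, where `K` realizes constants and `S`
realizes sequences as series in `z`. -/
def expansion {R : Type*} (K : ℝ → R) (S : (ℕ → ℝ) → R) (z : R) (b β₀ : ℝ) (ξ β α : ℕ → ℝ) :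
    Expansion R :=
  ⟨z, K b, K b⁻¹, K (Real.pi ^ 2 / 9 - 2 / 3), K β₀,
    S ξ, S (weighted 1 ξ), S (weighted 2 (weighted 1 ξ)),
    S β, S (weighted 1 β), S (weighted 2 (weighted 1 β)),
    S α, S (weighted 2 α), S (weighted 3 (weighted 2 α))⟩

/-- The expansion by formal power series in the inverse time. -/
def formalExpansion (b β₀ : ℝ) (ξ β α : ℕ → ℝ) : Expansion (PowerSeries ℝ) :=
  expansion PowerSeries.C PowerSeries.mk PowerSeries.X b β₀ ξ β α

/-- The formal power series with coefficients `ξ`, `β`, `α` solve the Euler-Lagrange equations. -/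
structure IsFormalSolution (b β₀ : ℝ) (ξ β α : ℕ → ℝ) : Prop where
  residualA_eq_zero : (formalExpansion b β₀ ξ β α).residualA = 0
  residualB_eq_zero : (formalExpansion b β₀ ξ β α).residualB = 0
  residualX_eq_zero : (formalExpansion b β₀ ξ β α).residualX = 0

/-! ### Existence of a formal solution -/

/-- The solution of a triangular system of equations `Q u n = 0`, found term by term with the
help of right inverses `s n` of the dependence of `Q u n` on `u n`. -/
def triangularSolution {E : Type*} [AddCommGroup E] (Q : (ℕ → E) → ℕ → E) (s : ℕ → E → E) : ℕ → E
  | n => s n (-Q (fun m => if m < n then triangularSolution Q s m else 0) n)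

theorem exists_of_triangular {E : Type*} [AddCommGroup E] (Q : (ℕ → E) → ℕ → E) (L : ℕ → E → E)
    (hL : ∀ n, Function.Surjective (L n))
    (h : ∀ u v n, (∀ m < n, u m = v m) → Q u n - Q v n = L n (u n - v n)) :
    ∃ u, ∀ n, Q u n = 0 := by
  choose s hs using hL
  let u := triangularSolution Q s
  refine ⟨u, fun n => ?_⟩
  have hu : u n = s n (-Q (fun m => if m < n then u m else 0) n) := triangularSolution.eq_1 Q s n
  have hQ := h u (fun m => if m < n then u m else 0) n fun m hm => (if_pos hm).symm
  rw [if_neg (lt_irrefl n), sub_zero, hu, hs] at hQ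
  exact sub_eq_neg_self.1 hQ

theorem lowerTriangular_surjective {c₁ c₂ c₃ c₄ c₅ c₆ : ℝ} (h₁ : c₁ ≠ 0) (h₃ : c₃ ≠ 0)
    (h₆ : c₆ ≠ 0) : Function.Surjective fun d : ℝ × ℝ × ℝ =>
      (c₁ * d.1, c₂ * d.1 + c₃ * d.2.1, c₄ * d.1 + c₅ * d.2.1 + c₆ * d.2.2) := by
  rintro ⟨s₁, s₂, s₃⟩
  have solve {c : ℝ} (hc : c ≠ 0) (s : ℝ) : ∃ x, c * x = s := ⟨s / c, mul_div_cancel₀ s hc⟩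
  obtain ⟨x, hx⟩ := solve h₁ s₁
  obtain ⟨y, hy⟩ := solve h₃ (s₂ - c₂ * x)
  obtain ⟨w, hw⟩ := solve h₆ (s₃ - c₄ * x - c₅ * y)
  refine ⟨(x, y, w), Prod.ext hx (Prod.ext ?_ ?_)⟩
  · simp only [hy, add_sub_cancel]
  · simp only [hw, sub_sub, add_sub_cancel]

section PowerSeries

open PowerSeries

variable {n : ℕ}

theorem coeff_mul_mk_sub (F : PowerSeries ℝ) {u v : ℕ → ℝ} (h : ∀ m < n, u m = v m) :
    coeff n (F * (PowerSeries.mk u - PowerSeries.mk v)) = coeff 0 F * (u n - v n) := by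
  have hdvd : X ^ n ∣ PowerSeries.mk u - PowerSeries.mk v := X_pow_dvd_iff.2 fun m hm => by
    rw [map_sub, coeff_mk, coeff_mk, h m hm, sub_self]
  obtain ⟨G, hG⟩ := hdvd
  have hn : u n - v n = coeff 0 G := by
    rw [← coeff_mk n u, ← coeff_mk n v, ← map_sub, hG, coeff_X_pow_mul', if_pos le_rfl,
      Nat.sub_self]
  rw [hG, mul_left_comm, coeff_X_pow_mul', if_pos le_rfl, Nat.sub_self, hn]
  simp only [coeff_zero_eq_constantCoeff, map_mul]

/-- Reduction of power series modulo `X ^ (n + 1)`. -/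
abbrev truncation (n : ℕ) :
    PowerSeries ℝ →+* PowerSeries ℝ ⧸ Ideal.span {(X : PowerSeries ℝ) ^ (n + 1)} :=
  Ideal.Quotient.mk _

theorem coeff_eq_of_truncation_eq {F G : PowerSeries ℝ} (h : truncation n F = truncation n G) :
    coeff n F = coeff n G := by
  rw [Ideal.Quotient.eq, Ideal.mem_span_singleton, X_pow_dvd_iff] at h
  exact sub_eq_zero.1 ((map_sub _ _ _).symm.trans (h n n.lt_succ_self))

theorem truncation_X_mul_mk_eq {u v : ℕ → ℝ} (h : ∀ m < n, u m = v m) :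
    truncation n X * truncation n (PowerSeries.mk u)
      = truncation n X * truncation n (PowerSeries.mk v) := by
  rw [← map_mul, ← map_mul, Ideal.Quotient.eq, Ideal.mem_span_singleton, ← mul_sub, pow_succ']
  refine mul_dvd_mul_left X (X_pow_dvd_iff.2 fun m hm => ?_)
  rw [map_sub, coeff_mk, coeff_mk, h m hm, sub_self]

theorem weighted_congr {u v : ℕ → ℝ} (k : ℕ) (h : ∀ m < n, u m = v m) :
    ∀ m < n, weighted k u m = weighted k v m := fun m hm => by rw [weighted, weighted, h m hm]

variable {b β₀ : ℝ} {ξ β α ξ' β' α' : ℕ → ℝ} (hξ : ∀ i < n, ξ i = ξ' i) (hβ : ∀ i < n, β i = β' i)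
  (hα : ∀ i < n, α i = α' i)
include hξ hβ hα

theorem shift_truncation_eq :
    ((formalExpansion b β₀ ξ β α).map (truncation n)).shift
      = ((formalExpansion b β₀ ξ' β' α').map (truncation n)).shift := by
  simp only [formalExpansion, expansion, Expansion.map, Expansion.shift, truncation_X_mul_mk_eq hξ,
    truncation_X_mul_mk_eq hβ, truncation_X_mul_mk_eq hα,
    truncation_X_mul_mk_eq (weighted_congr _ hξ), truncation_X_mul_mk_eq (weighted_congr _ hβ),
    truncation_X_mul_mk_eq (weighted_congr _ hα),
    truncation_X_mul_mk_eq (weighted_congr _ (weighted_congr _ hξ)),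
    truncation_X_mul_mk_eq (weighted_congr _ (weighted_congr _ hβ)),
    truncation_X_mul_mk_eq (weighted_congr _ (weighted_congr _ hα))]

theorem coeff_residualB_sub :
    coeff n (formalExpansion b β₀ ξ β α).residualB
        - coeff n (formalExpansion b β₀ ξ' β' α').residualB
      = 8 * b⁻¹ ^ 2 * (2 * (b⁻¹ ^ 2 - 1)) ^ 4 * (n + 1) * (ξ n - ξ' n) := by
  let e := formalExpansion b β₀ ξ β α
  let e' := formalExpansion b β₀ ξ' β' α'
  have hshift : (e.map (truncation n)).shift = (e'.map (truncation n)).shift :=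
    shift_truncation_eq hξ hβ hα
  have heq : truncation n (e.residualB - e'.residualB)
      = truncation n (4 * e.height ^ 2 * e.slope ^ 4 * (1 + e.place₁) * (e.x₁ - e'.x₁)) := by
    rw [map_sub, e.map_residualB, e'.map_residualB, Expansion.residualB_sub hshift]
    simp only [Expansion.height, Expansion.slope, Expansion.place₁, Expansion.map, map_add, map_sub,
      map_mul, map_pow, map_ofNat, map_one]
  rw [← map_sub, coeff_eq_of_truncation_eq heq]
  simp only [e, e', Expansion.height, Expansion.slope, Expansion.place₁, formalExpansion, expansion]
  rw [coeff_mul_mk_sub _ (weighted_congr 1 hξ)]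
  simp only [weighted, coeff_zero_eq_constantCoeff_apply, map_mul, map_add, map_sub, map_pow,
    map_ofNat, map_one, constantCoeff_X, constantCoeff_C]
  ring

theorem coeff_residualA_sub :
    coeff n (formalExpansion b β₀ ξ β α).residualA
        - coeff n (formalExpansion b β₀ ξ' β' α').residualA
      = 8 * b⁻¹ * (2 * (b⁻¹ ^ 2 - 1)) ^ 4 * (n + 1) * (ξ n - ξ' n)
        + 48 * b⁻¹ * (2 * b⁻¹ - b) * (2 * (b⁻¹ ^ 2 - 1)) ^ 3 * (α n - α' n) := by
  let e := formalExpansion b β₀ ξ β α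
  let e' := formalExpansion b β₀ ξ' β' α'
  have hshift : (e.map (truncation n)).shift = (e'.map (truncation n)).shift :=
    shift_truncation_eq hξ hβ hα
  have heq : truncation n (e.residualA - e'.residualA)
      = truncation n (4 * e.height * e.slope ^ 4 * (1 + e.place₁) * (e.x₁ - e'.x₁)
        + 48 * e.place * e.height * (2 * e.height - e.b) * e.slope ^ 3 * (e.a - e'.a)) := by
    rw [map_sub, e.map_residualA, e'.map_residualA, Expansion.residualA_sub hshift]
    simp only [Expansion.height, Expansion.slope, Expansion.place, Expansion.place₁, Expansion.map,
      map_add, map_sub, map_mul, map_pow, map_ofNat, map_one]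
  rw [← map_sub, coeff_eq_of_truncation_eq heq]
  simp only [e, e', Expansion.height, Expansion.slope, Expansion.place, Expansion.place₁,
    formalExpansion, expansion]
  rw [map_add, coeff_mul_mk_sub _ (weighted_congr 1 hξ), coeff_mul_mk_sub _ hα]
  simp only [weighted, coeff_zero_eq_constantCoeff_apply, map_mul, map_add, map_sub, map_pow,
    map_ofNat, map_one, constantCoeff_X, constantCoeff_C]
  ring

theorem coeff_residualX_sub :
    coeff n (formalExpansion b β₀ ξ β α).residualX
        - coeff n (formalExpansion b β₀ ξ' β' α').residualX
      = 4 * b⁻¹ * (b⁻¹ ^ 2 - 1) * (n + 1) ^ 2 * (ξ n - ξ' n)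
        + 8 * (b⁻¹ * (b⁻¹ - b) - (b⁻¹ ^ 2 - 1) * (n + 2)) * (α n - α' n)
        + -2 * b⁻¹ * (n + 1) * (β n - β' n) := by
  let e := formalExpansion b β₀ ξ β α
  let e' := formalExpansion b β₀ ξ' β' α'
  have hshift : (e.map (truncation n)).shift = (e'.map (truncation n)).shift :=
    shift_truncation_eq hξ hβ hα
  have heq : truncation n (e.residualX - e'.residualX)
      = truncation n (4 * e.height * (3 * e.height - e.r - 2 * e.b) * (e.a - e'.a)
        + -4 * e.slope * e.place₁ * (e.a₁ - e'.a₁) + -2 * e.height * e.place₁ * (e.y₁ - e'.y₁)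
        + -4 * e.height * (e.r ^ 2 - 1) * (e.x₁ - e'.x₁)
        + 2 * e.height * e.slope * (e.x₂ - e'.x₂)) := by
    rw [map_sub, e.map_residualX, e'.map_residualX, Expansion.residualX_sub hshift]
    simp only [Expansion.height, Expansion.slope, Expansion.place₁, Expansion.map, map_add, map_sub,
      map_mul, map_neg, map_pow, map_ofNat, map_one]
  rw [← map_sub, coeff_eq_of_truncation_eq heq]
  simp only [e, e', Expansion.height, Expansion.slope, Expansion.place₁, formalExpansion, expansion]
  rw [map_add, map_add, map_add, map_add, coeff_mul_mk_sub _ hα,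
    coeff_mul_mk_sub _ (weighted_congr 2 hα), coeff_mul_mk_sub _ (weighted_congr 1 hβ),
    coeff_mul_mk_sub _ (weighted_congr 1 hξ),
    coeff_mul_mk_sub _ (weighted_congr 2 (weighted_congr 1 hξ))]
  simp only [weighted, coeff_zero_eq_constantCoeff_apply, map_mul, map_add, map_sub, map_pow,
    map_neg, map_ofNat, map_one, constantCoeff_X, constantCoeff_C]
  push_cast
  ring

end PowerSeries

open PowerSeries in
theorem exists_isFormalSolution {b : ℝ} (hb0 : 0 < b) (hb1 : b < 1) (β₀ : ℝ) :
    ∃ ξ β α : ℕ → ℝ, IsFormalSolution b β₀ ξ β α := by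
  have hr : 1 < b⁻¹ := (one_lt_inv₀ hb0).2 hb1
  have hp : b⁻¹ ^ 2 - 1 ≠ 0 := (sub_pos.2 (one_lt_pow₀ hr two_ne_zero)).ne'
  have hq : 2 * b⁻¹ - b ≠ 0 := by linarith
  have hx (n : ℕ) : 8 * b⁻¹ ^ 2 * (2 * (b⁻¹ ^ 2 - 1)) ^ 4 * ((n : ℝ) + 1) ≠ 0 := by positivity
  have ha (_ : ℕ) : 48 * b⁻¹ * (2 * b⁻¹ - b) * (2 * (b⁻¹ ^ 2 - 1)) ^ 3 ≠ 0 := by positivity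
  have hy (n : ℕ) : -2 * b⁻¹ * ((n : ℝ) + 1) ≠ 0 := by
    rw [mul_assoc]
    exact mul_ne_zero (by norm_num) (by positivity)
  let e (u : ℕ → ℝ × ℝ × ℝ) := formalExpansion b β₀ (fun i => (u i).1) (fun i => (u i).2.2)
    fun i => (u i).2.1
  obtain ⟨u, hu⟩ := exists_of_triangular
    (fun u n => (coeff n (e u).residualB, coeff n (e u).residualA, coeff n (e u).residualX))
    _ (fun n => lowerTriangular_surjective (hx n) (ha n) (hy n))
    fun u v n h => by
      have hx : ∀ i < n, (u i).1 = (v i).1 := fun i hi => congrArg _ (h i hi)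
      have hy : ∀ i < n, (u i).2.2 = (v i).2.2 := fun i hi => congrArg (·.2.2) (h i hi)
      have ha : ∀ i < n, (u i).2.1 = (v i).2.1 := fun i hi => congrArg (·.2.1) (h i hi)
      exact Prod.ext (coeff_residualB_sub hx hy ha)
        (Prod.ext (coeff_residualA_sub hx hy ha) (coeff_residualX_sub hx hy ha))
  refine ⟨fun i => (u i).1, fun i => (u i).2.2, fun i => (u i).2.1, ?_, ?_, ?_⟩ <;> ext n
  · exact congrArg (·.2.1) (hu n)
  · exact congrArg (·.1) (hu n)
  · exact congrArg (·.2.2) (hu n)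

/-! ### The leading coefficients of a formal solution -/

section LeadingCoefficients

open PowerSeries

theorem coeff_two_mul (F G : PowerSeries ℝ) : coeff 2 (F * G)
    = constantCoeff F * coeff 2 G + coeff 1 F * coeff 1 G + coeff 2 F * constantCoeff G := by
  simp only [coeff_mul, Finset.Nat.sum_antidiagonal_eq_sum_range_succ_mk, Finset.sum_range_succ,
    Finset.sum_range_zero, zero_add, Nat.sub_zero, Nat.sub_self, Nat.reduceSub,
    coeff_zero_eq_constantCoeff]

theorem coeff_two_pow (F : PowerSeries ℝ) (k : ℕ) : coeff 2 (F ^ (k + 2))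
    = (k + 2) * constantCoeff F ^ (k + 1) * coeff 2 F
      + (k + 2) * (k + 1) / 2 * constantCoeff F ^ k * coeff 1 F ^ 2 := by
  induction k with
  | zero => rw [zero_add, pow_two, coeff_two_mul]; push_cast; ring
  | succ k ih =>
    rw [pow_succ, coeff_two_mul, ih, coeff_one_pow, map_pow, Nat.add_succ_sub_one]
    push_cast
    ring

theorem coeff_two_X : coeff 2 (X : PowerSeries ℝ) = 0 := by
  rw [coeff_X, if_neg (by decide)]

theorem coeff_succ_ofNat (k n : ℕ) [k.AtLeastTwo] :
    coeff (n + 1) (ofNat(k) : PowerSeries ℝ) = 0 := by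
  rw [← map_ofNat (C (R := ℝ)) k, coeff_succ_C]

theorem coeff_succ_one (n : ℕ) : coeff (n + 1) (1 : PowerSeries ℝ) = 0 := by
  rw [coeff_one, if_neg n.succ_ne_zero]

theorem eq_of_mul_sub_eq {k x y e : ℝ} (hk : k ≠ 0) (he : e = 0) (h : k * (x - y) = e) : x = y :=
  sub_eq_zero.1 ((mul_eq_zero.1 (h.trans he)).resolve_left hk)

namespace IsFormalSolution

variable {b β₀ : ℝ} {ξ β α : ℕ → ℝ} (hb0 : 0 < b) (hb1 : b < 1) (h : IsFormalSolution b β₀ ξ β α)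
include hb0 hb1 h

theorem coeff_zero_eq :
    ξ 0 = b ^ 2 / (8 * (1 - b ^ 2) ^ 2) ∧
    β 0 = b ^ 2 / (4 * (1 - b ^ 2)) * ((3 - 2 * b ^ 2) / (2 - b ^ 2)) ∧
    α 0 = b / (8 * (2 - b ^ 2)) := by
  have hq : 0 < 1 - b ^ 2 := by nlinarith
  have hs : 0 < 2 - b ^ 2 := by nlinarith
  have hp : b⁻¹ ^ 2 - 1 = (1 - b ^ 2) / b ^ 2 := by field_simp
  have hB := congrArg constantCoeff h.residualB_eq_zero
  have hA := congrArg constantCoeff h.residualA_eq_zero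
  have hX := congrArg constantCoeff h.residualX_eq_zero
  simp only [formalExpansion, expansion, Expansion.residualB, Expansion.residualA,
    Expansion.residualX, Expansion.height, Expansion.height₁, Expansion.height₂, Expansion.slope,
    Expansion.slope₁, Expansion.slope₂, Expansion.place, Expansion.place₁, map_add, map_sub,
    map_neg, map_mul, map_pow, map_ofNat, map_one, map_zero, constantCoeff_X, constantCoeff_C,
    constantCoeff_mk, weighted, ne_eq, OfNat.ofNat_ne_zero, not_false_eq_true, zero_pow, zero_mul,
    mul_zero, add_zero, sub_zero, hp] at hB hA hX
  have hξ : ξ 0 = b ^ 2 / (8 * (1 - b ^ 2) ^ 2) := by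
    refine eq_of_mul_sub_eq (k := 8 * b⁻¹ ^ 2 * (2 * ((1 - b ^ 2) / b ^ 2)) ^ 4)
      (by positivity) hB ?_
    field_simp
    ring
  have hα : α 0 = b / (8 * (2 - b ^ 2)) := by
    refine eq_of_mul_sub_eq (k := 48 * b⁻¹ * ((2 - b ^ 2) / b) * (2 * ((1 - b ^ 2) / b ^ 2)) ^ 3)
      (by positivity) hA ?_
    rw [hξ]
    field_simp
    ring
  refine ⟨hξ, ?_, hα⟩
  · refine eq_of_mul_sub_eq (k := -(2 * b⁻¹)) (neg_ne_zero.2 (by positivity)) hX ?_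
    rw [hξ, hα]
    push_cast
    field_simp
    ring

theorem coeff_one_eq :
    ξ 1 = b ^ 2 / (8 * (1 - b ^ 2) ^ 2) * -(b ^ 2 * β₀ / (2 * (1 - b ^ 2))) ∧
    β 1 = b ^ 2 / (4 * (1 - b ^ 2)) * -(β₀ / (2 * (1 - b ^ 2))) ∧
    α 1 = b / (8 * (2 - b ^ 2)) * -(b ^ 2 * β₀ / (2 * (1 - b ^ 2))) := by
  have hq : 0 < 1 - b ^ 2 := by nlinarith
  have hs : 0 < 2 - b ^ 2 := by nlinarith
  have hp : b⁻¹ ^ 2 - 1 = (1 - b ^ 2) / b ^ 2 := by field_simp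
  obtain ⟨hξ₀, -, hα₀⟩ := h.coeff_zero_eq hb0 hb1
  have hB := congrArg (coeff 1) h.residualB_eq_zero
  have hA := congrArg (coeff 1) h.residualA_eq_zero
  have hX := congrArg (coeff 1) h.residualX_eq_zero
  simp only [formalExpansion, expansion, Expansion.residualB, Expansion.residualA,
    Expansion.residualX, Expansion.height, Expansion.height₁, Expansion.height₂, Expansion.slope,
    Expansion.slope₁, Expansion.slope₂, Expansion.place, Expansion.place₁, coeff_one_mul,
    coeff_one_pow, map_add, map_sub, map_neg, map_mul, map_pow, map_ofNat, map_one, map_zero,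
    coeff_succ_C, coeff_one_X, coeff_mk, coeff_succ_ofNat, coeff_succ_one, constantCoeff_X,
    constantCoeff_C, constantCoeff_mk, weighted, ne_eq, OfNat.ofNat_ne_zero, not_false_eq_true,
    zero_pow, zero_mul, mul_zero, add_zero, zero_add, sub_zero, hp] at hB hA hX
  have hξ : ξ 1 = b ^ 2 / (8 * (1 - b ^ 2) ^ 2) * -(b ^ 2 * β₀ / (2 * (1 - b ^ 2))) := by
    refine eq_of_mul_sub_eq (k := 16 * b⁻¹ ^ 2 * (2 * ((1 - b ^ 2) / b ^ 2)) ^ 4)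
      (by positivity) hB ?_
    rw [hξ₀]
    push_cast
    field_simp
    ring
  have hα : α 1 = b / (8 * (2 - b ^ 2)) * -(b ^ 2 * β₀ / (2 * (1 - b ^ 2))) := by
    refine eq_of_mul_sub_eq (k := 48 * b⁻¹ * ((2 - b ^ 2) / b) * (2 * ((1 - b ^ 2) / b ^ 2)) ^ 3)
      (by positivity) hA ?_
    rw [hξ, hξ₀, hα₀]
    push_cast
    field_simp
    ring
  refine ⟨hξ, ?_, hα⟩
  refine eq_of_mul_sub_eq (k := -(4 * b⁻¹)) (neg_ne_zero.2 (by positivity)) hX ?_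
  rw [hξ, hα, hξ₀, hα₀]
  push_cast
  field_simp
  ring

theorem coeff_two_x_eq :
    ξ 2 = b ^ 2 / (8 * (1 - b ^ 2) ^ 2)
      * (b ^ 4 * β₀ ^ 2 / (4 * (1 - b ^ 2) ^ 2) + Real.pi ^ 2 * b ^ 2 / 12
        + b ^ 2 * (12 * b ^ 6 - 44 * b ^ 4 + 53 * b ^ 2 - 22)
          / (16 * (2 - b ^ 2) * (1 - b ^ 2) ^ 2)) := by
  have hq : 0 < 1 - b ^ 2 := by nlinarith
  have hs : 0 < 2 - b ^ 2 := by nlinarith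
  have hp : b⁻¹ ^ 2 - 1 = (1 - b ^ 2) / b ^ 2 := by field_simp
  obtain ⟨hξ₀, hβ₀, hα₀⟩ := h.coeff_zero_eq hb0 hb1
  obtain ⟨hξ₁, -, hα₁⟩ := h.coeff_one_eq hb0 hb1
  have h₂ := congrArg (coeff 2) h.residualB_eq_zero
  simp only [formalExpansion, expansion, Expansion.residualB, Expansion.height, Expansion.height₁,
    Expansion.height₂, Expansion.slope, Expansion.slope₁, Expansion.slope₂, Expansion.place₁,
    coeff_two_mul, coeff_two_pow, coeff_two_X, coeff_one_mul, coeff_one_pow, map_add, map_sub,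
    map_neg, map_mul, map_pow, map_ofNat, map_one, map_zero, coeff_succ_C, coeff_one_X, coeff_mk,
    coeff_succ_ofNat, coeff_succ_one, constantCoeff_X, constantCoeff_C, constantCoeff_mk, weighted,
    ne_eq, OfNat.ofNat_ne_zero, not_false_eq_true, zero_pow, zero_mul, mul_zero, add_zero, zero_add,
    sub_zero, hp] at h₂
  refine eq_of_mul_sub_eq (k := 24 * b⁻¹ ^ 2 * (2 * ((1 - b ^ 2) / b ^ 2)) ^ 4)
    (by positivity) h₂ ?_
  rw [hξ₀, hξ₁, hα₀, hα₁, hβ₀]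
  push_cast
  field_simp
  ring

theorem coeff_two_a_eq :
    α 2 = b / (8 * (2 - b ^ 2))
      * (b ^ 4 * β₀ ^ 2 / (4 * (1 - b ^ 2) ^ 2) - Real.pi ^ 2 * b ^ 2 / (18 * (1 - b ^ 2))
        - b ^ 2 * (17 * b ^ 6 - 91 * b ^ 4 + 148 * b ^ 2 - 62)
          / (24 * (1 - b ^ 2) ^ 2 * (2 - b ^ 2) ^ 2)) := by
  have hq : 0 < 1 - b ^ 2 := by nlinarith
  have hs : 0 < 2 - b ^ 2 := by nlinarith
  have hp : b⁻¹ ^ 2 - 1 = (1 - b ^ 2) / b ^ 2 := by field_simp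
  obtain ⟨hξ₀, hβ₀, hα₀⟩ := h.coeff_zero_eq hb0 hb1
  obtain ⟨hξ₁, -, hα₁⟩ := h.coeff_one_eq hb0 hb1
  have hξ₂ := h.coeff_two_x_eq hb0 hb1
  have h₂ := congrArg (coeff 2) h.residualA_eq_zero
  simp only [formalExpansion, expansion, Expansion.residualA, Expansion.height, Expansion.height₁,
    Expansion.height₂, Expansion.slope, Expansion.slope₁, Expansion.slope₂, Expansion.place,
    Expansion.place₁, coeff_two_mul, coeff_two_pow, coeff_two_X, coeff_one_mul, coeff_one_pow,
    map_add, map_sub, map_neg, map_mul, map_pow, map_ofNat, map_one, map_zero, coeff_succ_C,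
    coeff_one_X, coeff_mk, coeff_succ_ofNat, coeff_succ_one, constantCoeff_X, constantCoeff_C,
    constantCoeff_mk, weighted, ne_eq, OfNat.ofNat_ne_zero, not_false_eq_true, zero_pow, zero_mul,
    mul_zero, add_zero, zero_add, sub_zero, hp] at h₂
  refine eq_of_mul_sub_eq (k := 48 * b⁻¹ * ((2 - b ^ 2) / b) * (2 * ((1 - b ^ 2) / b ^ 2)) ^ 3)
    (by positivity) h₂ ?_
  rw [hξ₂, hξ₀, hξ₁, hα₀, hα₁, hβ₀]
  push_cast
  field_simp
  ring

theorem coeff_two_y_eq :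
    β 2 = b ^ 2 / (4 * (1 - b ^ 2))
      * (b ^ 2 * β₀ ^ 2 / (4 * (1 - b ^ 2) ^ 2)
        + Real.pi ^ 2 * (22 - 13 * b ^ 2) / (36 * (2 - b ^ 2))
        + (80 * b ^ 10 - 686 * b ^ 8 + 2213 * b ^ 6 - 3368 * b ^ 4 + 2450 * b ^ 2 - 692)
          / (48 * (1 - b ^ 2) ^ 2 * (2 - b ^ 2) ^ 3)) := by
  have hq : 0 < 1 - b ^ 2 := by nlinarith
  have hs : 0 < 2 - b ^ 2 := by nlinarith
  have hp : b⁻¹ ^ 2 - 1 = (1 - b ^ 2) / b ^ 2 := by field_simp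
  obtain ⟨hξ₀, hβ₀, hα₀⟩ := h.coeff_zero_eq hb0 hb1
  obtain ⟨hξ₁, -, hα₁⟩ := h.coeff_one_eq hb0 hb1
  have hξ₂ := h.coeff_two_x_eq hb0 hb1
  have hα₂ := h.coeff_two_a_eq hb0 hb1
  have h₂ := congrArg (coeff 2) h.residualX_eq_zero
  simp only [formalExpansion, expansion, Expansion.residualX, Expansion.height, Expansion.slope,
    Expansion.place₁, coeff_two_mul, coeff_two_pow, coeff_two_X, coeff_one_mul, coeff_one_pow,
    map_add, map_sub, map_mul, map_pow, map_ofNat, map_one, map_zero, coeff_succ_C, coeff_one_X,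
    coeff_mk, coeff_succ_ofNat, coeff_succ_one, constantCoeff_X, constantCoeff_C, constantCoeff_mk,
    weighted, ne_eq, OfNat.ofNat_ne_zero, not_false_eq_true, zero_pow, zero_mul, mul_zero, add_zero,
    zero_add, sub_zero, hp] at h₂
  refine eq_of_mul_sub_eq (k := -(6 * b⁻¹)) (neg_ne_zero.2 (by positivity)) h₂ ?_
  rw [hξ₂, hα₂, hξ₀, hξ₁, hα₀, hα₁, hβ₀]
  push_cast
  field_simp
  ring

end IsFormalSolution

end LeadingCoefficients

/-! ### Truncation of the formal solution -/

/-- The sum of the first `N` terms of the power series with coefficients `u`. -/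
def partialSum (N : ℕ) (u : ℕ → ℝ) (z : ℝ) : ℝ :=
  (PowerSeries.trunc N (PowerSeries.mk u)).eval z

/-- The expansion at the inverse time `z` with all series cut off after `N` terms. -/
def truncatedExpansion (b β₀ : ℝ) (ξ β α : ℕ → ℝ) (N : ℕ) (z : ℝ) : Expansion ℝ :=
  expansion id (fun u => partialSum N u z) z b β₀ ξ β α

@[fun_prop]
theorem continuous_partialSum (N : ℕ) (u : ℕ → ℝ) : Continuous (partialSum N u) :=
  (PowerSeries.trunc N (PowerSeries.mk u)).continuous

theorem mk_coe_trunc (N : ℕ) (f : PowerSeries ℝ) :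
    Ideal.Quotient.mk (Ideal.span {(PowerSeries.X : PowerSeries ℝ) ^ N})
        (PowerSeries.trunc N f : PowerSeries ℝ)
      = Ideal.Quotient.mk _ f := by
  rw [Ideal.Quotient.eq, Ideal.mem_span_singleton, PowerSeries.X_pow_dvd_iff]
  intro i hi
  rw [map_sub, Polynomial.coeff_coe, PowerSeries.coeff_trunc, if_pos hi, sub_self]

theorem X_pow_dvd_of_mk_coe_eq_zero {N : ℕ} {p : Polynomial ℝ}
    (h : Ideal.Quotient.mk (Ideal.span {(PowerSeries.X : PowerSeries ℝ) ^ N})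
      (p : PowerSeries ℝ) = 0) :
    Polynomial.X ^ N ∣ p := by
  rw [Ideal.Quotient.eq_zero_iff_mem, Ideal.mem_span_singleton, PowerSeries.X_pow_dvd_iff] at h
  exact Polynomial.X_pow_dvd_iff.2 fun i hi => by rw [← Polynomial.coeff_coe, h i hi]

/-- The truncation and the formal expansion agree modulo `z ^ N`, and `hE` makes `E` commute with
the reduction modulo `z ^ N`. -/
theorem exists_eval_truncatedExpansion_eq {E : ∀ {R : Type} [CommRing R], Expansion R → R}
    (hE : ∀ {R R' : Type} [CommRing R] [CommRing R'] (e : Expansion R) (F : R →+* R'),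
      F (E e) = E (e.map F))
    {b β₀ : ℝ} {ξ β α : ℕ → ℝ} (h : E (formalExpansion b β₀ ξ β α) = 0) (N : ℕ) :
    ∃ q : Polynomial ℝ, ∀ z, E (truncatedExpansion b β₀ ξ β α N z) = z ^ N * q.eval z := by
  let e : Expansion (Polynomial ℝ) := expansion Polynomial.C
    (fun u => PowerSeries.trunc N (PowerSeries.mk u)) Polynomial.X b β₀ ξ β α
  let quotient := Ideal.Quotient.mk (Ideal.span {(PowerSeries.X : PowerSeries ℝ) ^ N})
  have hmap : e.map (quotient.comp Polynomial.coeToPowerSeries.ringHom)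
      = (formalExpansion b β₀ ξ β α).map quotient := by
    simp only [e, quotient, Expansion.map, formalExpansion, expansion, RingHom.comp_apply,
      Polynomial.coeToPowerSeries.ringHom_apply, mk_coe_trunc, Polynomial.coe_C, Polynomial.coe_X]
  obtain ⟨q, hq⟩ : Polynomial.X ^ N ∣ E e := X_pow_dvd_of_mk_coe_eq_zero <|
    calc quotient ((E e : Polynomial ℝ) : PowerSeries ℝ)
        = E (e.map (quotient.comp Polynomial.coeToPowerSeries.ringHom)) := by
          rw [← hE, RingHom.comp_apply, Polynomial.coeToPowerSeries.ringHom_apply]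
      _ = 0 := by rw [hmap, ← hE, h, map_zero]
  refine ⟨q, fun z => ?_⟩
  have hz : e.map (Polynomial.evalRingHom z) = truncatedExpansion b β₀ ξ β α N z := by
    simp only [e, Expansion.map, truncatedExpansion, expansion, partialSum,
      Polynomial.coe_evalRingHom, Polynomial.eval_C, Polynomial.eval_X, id]
  rw [← hz, ← hE, hq, map_mul, map_pow, Polynomial.coe_evalRingHom, Polynomial.eval_X]

/-! ### The truncated curve -/

/-- The function `∑ i < N, u i * (t + T)⁻¹ ^ (i + k)`. -/
def tail (T : ℝ) (N k : ℕ) (u : ℕ → ℝ) (t : ℝ) : ℝ :=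
  (t + T)⁻¹ ^ k * partialSum N u (t + T)⁻¹

theorem tendsto_inv_add (T : ℝ) : Tendsto (fun t : ℝ => (t + T)⁻¹) atTop (nhds 0) :=
  tendsto_inv_atTop_zero.comp (tendsto_atTop_add_const_right _ T tendsto_id)

theorem eventually_add_ne_zero (T : ℝ) : ∀ᶠ t in atTop, t + T ≠ 0 :=
  (tendsto_atTop_add_const_right _ T tendsto_id).eventually_ne_atTop 0

theorem partialSum_weighted (N k : ℕ) (u : ℕ → ℝ) (z : ℝ) :
    partialSum N (weighted k u) z = k * partialSum N u z
      + z * (Polynomial.derivative (PowerSeries.trunc N (PowerSeries.mk u))).eval z := by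
  have heq : PowerSeries.trunc N (PowerSeries.mk (weighted k u))
      = Polynomial.C (k : ℝ) * PowerSeries.trunc N (PowerSeries.mk u)
        + Polynomial.X * Polynomial.derivative (PowerSeries.trunc N (PowerSeries.mk u)) := by
    ext n
    rw [Polynomial.coeff_add, Polynomial.coeff_C_mul]
    cases n with
    | zero => simp [PowerSeries.coeff_trunc, weighted]
    | succ n =>
      rw [Polynomial.coeff_X_mul, Polynomial.coeff_derivative]
      simp only [PowerSeries.coeff_trunc, PowerSeries.coeff_mk, weighted]
      split_ifs <;> push_cast <;> ring
  simp only [partialSum, heq, Polynomial.eval_add, Polynomial.eval_mul, Polynomial.eval_C,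
    Polynomial.eval_X]

theorem hasDerivAt_tail {T t : ℝ} (ht : t + T ≠ 0) (N k : ℕ) (u : ℕ → ℝ) :
    HasDerivAt (tail T N k u) (-tail T N (k + 1) (weighted k u) t) t := by
  have hinv : HasDerivAt (fun t : ℝ => (t + T)⁻¹) (-(t + T)⁻¹ ^ 2) t := by
    refine (((hasDerivAt_id t).add_const T).fun_inv ht).congr_deriv ?_
    rw [id, neg_div, one_div, inv_pow]
  have hsum := ((PowerSeries.trunc N (PowerSeries.mk u)).hasDerivAt (t + T)⁻¹).comp t hinv
  refine ((hinv.pow k).mul hsum).congr_deriv ?_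
  rw [tail, partialSum_weighted]
  simp only [partialSum, Function.comp_apply, Pi.pow_apply]
  generalize (t + T)⁻¹ = z
  cases k with
  | zero => ring
  | succ k => simp only [Nat.add_sub_cancel]; ring

theorem sum_Ico_eq_tail (T : ℝ) (N k : ℕ) (u : ℕ → ℝ) (t : ℝ) :
    ∑ n ∈ Finset.Ico k (N + k), u (n - k) / (t + T) ^ n = tail T N k u t := by
  rw [Finset.sum_Ico_eq_sum_range, Nat.add_sub_cancel, tail, partialSum, Polynomial.eval,
    PowerSeries.eval₂_trunc_eq_sum_range, Finset.mul_sum]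
  refine Finset.sum_congr rfl fun i _ => ?_
  rw [Nat.add_sub_cancel_left, PowerSeries.coeff_mk, pow_add, RingHom.id_apply, div_eq_mul_inv,
    mul_inv, inv_pow, inv_pow]
  ring

theorem tendsto_tail_succ (T : ℝ) (N k : ℕ) (u : ℕ → ℝ) :
    Tendsto (tail T N (k + 1) u) atTop (nhds 0) := by
  have hcont : Continuous fun z : ℝ => z ^ (k + 1) * partialSum N u z := by fun_prop
  have hlim := (hcont.tendsto 0).comp (tendsto_inv_add T)
  rwa [zero_pow k.succ_ne_zero, zero_mul] at hlim

theorem tame_tail_succ (T : ℝ) (N k : ℕ) (u : ℕ → ℝ) : Tame (tail T N (k + 1) u) :=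
  ⟨0, by simpa using (tendsto_tail_succ T N k u).isBigO_one ℝ⟩

theorem tameJet_affine_add_tail (T p c : ℝ) (N k : ℕ) (u : ℕ → ℝ) :
    TameJet (fun t => p * (t + T) + c + tail T N (k + 1) u t)
      (fun t => p - tail T N (k + 2) (weighted (k + 1) u) t)
      (tail T N (k + 3) (weighted (k + 2) (weighted (k + 1) u))) where
  jet := by
    have hderiv (t : ℝ) (ht : t + T ≠ 0) :
        HasDerivAt (fun t => p * (t + T) + c + tail T N (k + 1) u t)
          (p - tail T N (k + 2) (weighted (k + 1) u) t) t :=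
      (((((hasDerivAt_id t).add_const T).const_mul p).add_const c).fun_add
        (hasDerivAt_tail ht N (k + 1) u)).congr_deriv (by rw [mul_one, sub_eq_add_neg])
    filter_upwards [eventually_add_ne_zero T] with t ht
    have hcont : ContinuousAt (fun s => s + T) t := by fun_prop
    exact ⟨(hcont.eventually_ne ht).mono hderiv,
      ((hasDerivAt_tail ht N (k + 2) _).const_sub p).congr_deriv (neg_neg _)⟩
  tame₀ := by
    have hid : Tame fun t => t :=
      ⟨1, by simpa only [pow_one] using isBigO_refl (fun t : ℝ => t) atTop⟩
    exact (((Tame.const p).mul (hid.add (.const T))).add (.const c)).add (tame_tail_succ T N k u)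
  tame₁ := by
    simpa only [neg_one_mul, ← sub_eq_add_neg] using
      (Tame.const p).add ((Tame.const (-1)).mul (tame_tail_succ T N (k + 1) _))
  tame₂ := tame_tail_succ T N (k + 2) _

theorem seriesA_eq_tail (b T : ℝ) (α : ℕ → ℝ) (N : ℕ) :
    seriesA b T (fun n => α (n - 2)) (N + 1)
      = fun t => 0 * (t + T) + b⁻¹ + tail T N 2 α t := by
  funext t
  rw [← sum_Ico_eq_tail, seriesA, one_div, zero_mul, zero_add]
  rfl

theorem seriesB_eq_tail {b : ℝ} (hb : b ≠ 0) (T β₀ : ℝ) (β : ℕ → ℝ) (N : ℕ) :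
    seriesB b T β₀ (fun n => β (n - 1)) N
      = fun t => 2 * (b⁻¹ ^ 2 - 1) * (t + T) + β₀ + tail T N 1 β t := by
  funext t
  have hslope : 2 * (1 - b ^ 2) / b ^ 2 = 2 * (b⁻¹ ^ 2 - 1) := by field_simp
  rw [← sum_Ico_eq_tail, seriesB, hslope]
  rfl

theorem seriesX_eq_tail (T : ℝ) (ξ : ℕ → ℝ) (N : ℕ) :
    seriesX T (fun n => ξ (n - 1)) N = fun t => 1 * (t + T) + 0 + tail T N 1 ξ t := by
  funext t
  rw [← sum_Ico_eq_tail, seriesX, one_mul, add_zero]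
  rfl

theorem two_mul_inv_sq_sub_one_pos {b : ℝ} (hb0 : 0 < b) (hb1 : b < 1) :
    0 < 2 * (b⁻¹ ^ 2 - 1) := by
  nlinarith [(one_lt_inv₀ hb0).2 hb1]

theorem tendsto_seriesB {b : ℝ} (hb0 : 0 < b) (hb1 : b < 1) (T β₀ : ℝ) (β : ℕ → ℝ) (N : ℕ) :
    Tendsto (seriesB b T β₀ (fun n => β (n - 1)) N) atTop atTop := by
  rw [seriesB_eq_tail hb0.ne']
  exact (tendsto_atTop_add_const_right _ _ ((tendsto_atTop_add_const_right _ T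
    tendsto_id).const_mul_atTop (two_mul_inv_sq_sub_one_pos hb0 hb1))).atTop_add
    (tendsto_tail_succ T N 0 β)

theorem eventually_le_seriesX (T : ℝ) (ξ : ℕ → ℝ) (N : ℕ) :
    ∀ᶠ t in atTop, t + T - 1 ≤ seriesX T (fun n => ξ (n - 1)) N t := by
  filter_upwards [(tendsto_tail_succ T N 0 ξ).eventually (eventually_ge_nhds neg_one_lt_zero)]
    with t ht
  rw [seriesX_eq_tail]
  linarith

section Curve

variable {b : ℝ} (hb0 : 0 < b) (β₀ : ℝ) (ξ β α : ℕ → ℝ) (T : ℝ) (N : ℕ)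
include hb0

theorem wideCurve_series (hb1 : b < 1) :
    WideCurve (seriesA b T (fun n => α (n - 2)) (N + 1))
      (fun t => (truncatedExpansion b β₀ ξ β α N (t + T)⁻¹).height₁)
      (fun t => (truncatedExpansion b β₀ ξ β α N (t + T)⁻¹).height₂)
      (seriesB b T β₀ (fun n => β (n - 1)) N)
      (fun t => (truncatedExpansion b β₀ ξ β α N (t + T)⁻¹).slope₁)
      (fun t => (truncatedExpansion b β₀ ξ β α N (t + T)⁻¹).slope₂)
      (seriesX T (fun n => ξ (n - 1)) N)
      (fun t => (truncatedExpansion b β₀ ξ β α N (t + T)⁻¹).place₁)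
      (fun t => (truncatedExpansion b β₀ ξ β α N (t + T)⁻¹).place₂) where
  jetA := by
    have hheight₁ : (fun t => (truncatedExpansion b β₀ ξ β α N (t + T)⁻¹).height₁)
        = fun t => 0 - tail T N 3 (weighted 2 α) t := funext fun t => (zero_sub _).symm
    rw [seriesA_eq_tail, hheight₁]
    exact tameJet_affine_add_tail T 0 b⁻¹ N 1 α
  jetB := by
    rw [seriesB_eq_tail hb0.ne']
    exact tameJet_affine_add_tail T _ β₀ N 0 β
  jetX := by
    rw [seriesX_eq_tail]
    exact tameJet_affine_add_tail T 1 0 N 0 ξ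
  tame_inv :=
    ⟨0, by simpa using (tendsto_seriesB hb0 hb1 T β₀ β N).inv_tendsto_atTop.isBigO_one ℝ⟩
  pos := by
    filter_upwards [(tendsto_seriesB hb0 hb1 T β₀ β N).eventually_gt_atTop 0,
      eventually_le_seriesX T ξ N, eventually_gt_atTop (1 - T)] with t hB hX ht
    exact ⟨hB, by linarith⟩
  le := by
    filter_upwards [(tendsto_seriesB hb0 hb1 T β₀ β N).eventually_ge_atTop 2,
      eventually_le_seriesX T ξ N, eventually_gt_atTop (1 - T), eventually_gt_atTop (2 - 2 * T)]
      with t hB hX ht ht'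
    nlinarith

theorem series_eq_truncatedExpansion {t : ℝ} (ht : t + T ≠ 0) :
    let e := truncatedExpansion b β₀ ξ β α N (t + T)⁻¹
    seriesA b T (fun n => α (n - 2)) (N + 1) t = e.height ∧
      seriesB b T β₀ (fun n => β (n - 1)) N t = e.slope / e.z ∧
      seriesX T (fun n => ξ (n - 1)) N t = e.place / e.z := by
  simp only [seriesA_eq_tail, seriesB_eq_tail hb0.ne', seriesX_eq_tail, tail, Expansion.height,
    Expansion.slope, Expansion.place, truncatedExpansion, expansion, id]
  refine ⟨by ring, ?_, ?_⟩
  · field_simp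
  · field_simp
    ring

end Curve

/-! ### The Euler-Lagrange expressions of the truncated curve -/

namespace Expansion

variable {e : Expansion ℝ} (hb : e.b ≠ 0) (hr : e.r = e.b⁻¹) (hm : e.m = Real.pi ^ 2 / 9 - 2 / 3)
  (hz : e.z ≠ 0) (hslope : e.slope ≠ 0)

variable (e) in
/-- `limA` at the coordinates of an expansion. -/
def limA : ℝ :=
  Sphaleron.limA e.b e.height e.height₁ e.height₂ (e.slope / e.z) e.slope₁ e.slope₂
    (e.place / e.z) e.place₁ e.place₂

variable (e) in
/-- `limB` at the coordinates of an expansion. -/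
def limB : ℝ :=
  Sphaleron.limB e.b e.height e.height₁ e.height₂ (e.slope / e.z) e.slope₁ e.slope₂ e.place₁

variable (e) in
/-- `limX` at the coordinates of an expansion. -/
def limX : ℝ :=
  Sphaleron.limX e.b e.height e.height₁ e.height₂ (e.slope / e.z) e.slope₁ e.place₁ e.place₂

variable (e) in
/-- `limEnergy` at the coordinates of an expansion. -/
def limEnergy : ℝ :=
  Sphaleron.limEnergy e.b e.height e.height₁ (e.slope / e.z) e.slope₁ (e.place / e.z) e.place₁

include hb hr hm hz hslope in
theorem limA_eq_residualA : e.limA = e.z * e.residualA / (6 * e.slope ^ 3) := by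
  simp only [limA, Sphaleron.limA, residualA, height, height₁, height₂, place, place₁, place₂, hr,
    hm]
  field_simp
  ring

include hb hr hm hslope in
theorem limB_eq_residualB : e.limB = e.z ^ 2 * e.residualB / (12 * e.slope ^ 4) := by
  simp only [limB, Sphaleron.limB, residualB, place₁, hr, hm]
  field_simp
  ring

include hb hr in
theorem limX_eq_residualX : e.limX = e.z ^ 2 * e.height * e.residualX / 3 := by
  simp only [limX, Sphaleron.limX, residualX, height₁, height₂, height, place₁, place₂, slope,
    slope₁, hr]
  field_simp
  ring

variable (e) in
/-- The deviation of `limEnergy` from its limit as `z → 0`, divided by `z`. -/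
def energyRemainder : ℝ :=
  2 / 3 * (e.r ^ 2 * e.y + (2 * e.r * e.a + e.z ^ 2 * e.a ^ 2) * e.slope)
    - 2 / 3 * e.height ^ 2 * e.slope * e.x₁ + e.z ^ 2 * e.height ^ 2 * e.slope * e.x₁ ^ 2 / 3
    + 2 / 3 * e.z ^ 2 * e.a ^ 2
      * (6 * e.height ^ 2 + 4 * (e.r - e.b) * e.height + 2 * (e.r ^ 2 - 1))
    + 1 / 2 * (e.z ^ 4 * e.a₁ ^ 2 * (2 * e.place - e.z ^ 2 / e.slope)
      + e.m / 2 * e.height ^ 2 * e.slope₁ ^ 2 * e.z ^ 2 / e.slope ^ 3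
      - e.height * e.z ^ 4 * e.a₁ * e.slope₁ / e.slope ^ 2
      - 2 * e.height * e.z ^ 2 * e.a₁ * e.place₁)
    + 2 * e.x * (2 * e.height ^ 4 - 4 / 3 * (2 * e.r + e.b) * e.height ^ 3 + 2 * e.height ^ 2)
    - (11 / 3 * e.height ^ 4 - (4 * e.r + 2 * e.b) * e.height ^ 3 + 2 * e.height ^ 2) / e.slope

include hb hr hm hz hslope in
theorem limEnergy_eq_add_energyRemainder :
    e.limEnergy = 2 / 3 * e.β₀ / e.b ^ 2 + e.z * e.energyRemainder := by
  have hy : e.y = (e.slope - 2 * (e.b⁻¹ ^ 2 - 1) - e.z * e.β₀) / e.z ^ 2 := by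
    rw [slope, hr]
    field_simp
    ring
  simp only [limEnergy, Sphaleron.limEnergy, energyRemainder, height₁, height, place, place₁, hy,
    hr, hm]
  field_simp
  ring

end Expansion

/-! ### Decay of the Euler-Lagrange expressions -/

theorem isBigO_comp_inv_add (T : ℝ) {φ : ℝ → ℝ} (hφ : ContinuousAt φ 0) :
    (fun t => φ (t + T)⁻¹) =O[atTop] fun _ => (1 : ℝ) :=
  (hφ.tendsto.comp (tendsto_inv_add T)).isBigO_one ℝ

theorem isBigO_inv_add (T : ℝ) : (fun t : ℝ => (t + T)⁻¹) =O[atTop] fun t : ℝ => t⁻¹ := by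
  refine IsBigO.of_bound 2 ?_
  filter_upwards [eventually_gt_atTop (0 : ℝ), eventually_gt_atTop (-2 * T)] with t ht htT
  have hle : t / 2 ≤ t + T := by linarith
  rw [Real.norm_of_nonneg (inv_nonneg.2 (by linarith)), Real.norm_of_nonneg (by positivity)]
  calc (t + T)⁻¹ ≤ (t / 2)⁻¹ := inv_anti₀ (by positivity) hle
    _ = 2 * t⁻¹ := by field_simp

theorem isBigO_inv_add_pow_mul (T : ℝ) (n : ℕ) {φ : ℝ → ℝ} (hφ : ContinuousAt φ 0) :
    (fun t : ℝ => (t + T)⁻¹ ^ n * φ (t + T)⁻¹) =O[atTop] fun t : ℝ => (t ^ n)⁻¹ := by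
  simpa only [inv_pow, mul_one] using ((isBigO_inv_add T).pow n).mul (isBigO_comp_inv_add T hφ)

theorem isBigO_inv_pow_of_le {m n : ℕ} (h : m ≤ n) :
    (fun t : ℝ => (t ^ n)⁻¹) =O[atTop] fun t => (t ^ m)⁻¹ := by
  refine (IsBigO.pow_of_le_right (eventually_ge_atTop 1) h).inv_rev ?_
  filter_upwards [eventually_gt_atTop 0] with t ht hzero
  exact absurd hzero (pow_pos ht m).ne'

section Truncation

variable {b β₀ : ℝ} {ξ β α : ℕ → ℝ}

theorem truncatedExpansion_slope_zero (b β₀ : ℝ) (ξ β α : ℕ → ℝ) (N : ℕ) :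
    (truncatedExpansion b β₀ ξ β α N 0).slope = 2 * (b⁻¹ ^ 2 - 1) := by
  simp [Expansion.slope, truncatedExpansion, expansion]

theorem continuous_truncatedExpansion_slope (b β₀ : ℝ) (ξ β α : ℕ → ℝ) (N : ℕ) :
    Continuous fun z => (truncatedExpansion b β₀ ξ β α N z).slope := by
  simp only [Expansion.slope, truncatedExpansion, expansion, id]
  fun_prop

theorem continuous_truncatedExpansion_height (b β₀ : ℝ) (ξ β α : ℕ → ℝ) (N : ℕ) :
    Continuous fun z => (truncatedExpansion b β₀ ξ β α N z).height := by
  simp only [Expansion.height, truncatedExpansion, expansion, id]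
  fun_prop

theorem continuous_truncatedExpansion_place (b β₀ : ℝ) (ξ β α : ℕ → ℝ) (N : ℕ) :
    Continuous fun z => (truncatedExpansion b β₀ ξ β α N z).place := by
  simp only [Expansion.place, truncatedExpansion, expansion, id]
  fun_prop

variable (hb0 : 0 < b) (hb1 : b < 1)
include hb0 hb1

theorem truncatedExpansion_slope_zero_ne_zero (β₀ : ℝ) (ξ β α : ℕ → ℝ) (N : ℕ) :
    (truncatedExpansion b β₀ ξ β α N 0).slope ≠ 0 := by
  rw [truncatedExpansion_slope_zero]
  exact (two_mul_inv_sq_sub_one_pos hb0 hb1).ne'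

theorem continuousAt_div_slope_pow (β₀ : ℝ) (ξ β α : ℕ → ℝ) (N k : ℕ) {φ : ℝ → ℝ}
    (hφ : Continuous φ) :
    ContinuousAt (fun z => φ z / (truncatedExpansion b β₀ ξ β α N z).slope ^ k) 0 :=
  hφ.continuousAt.div ((continuous_truncatedExpansion_slope b β₀ ξ β α N).pow k).continuousAt
    (pow_ne_zero k (truncatedExpansion_slope_zero_ne_zero hb0 hb1 β₀ ξ β α N))

theorem eventually_inv_add_ne_zero_and_slope_ne_zero (β₀ : ℝ) (ξ β α : ℕ → ℝ) (T : ℝ) (N : ℕ) :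
    ∀ᶠ t in atTop, (truncatedExpansion b β₀ ξ β α N (t + T)⁻¹).z ≠ 0 ∧
      (truncatedExpansion b β₀ ξ β α N (t + T)⁻¹).slope ≠ 0 :=
  ((eventually_add_ne_zero T).mono fun _ => inv_ne_zero).and
    (((continuous_truncatedExpansion_slope b β₀ ξ β α N).continuousAt.tendsto.comp
      (tendsto_inv_add T)).eventually_ne
        (truncatedExpansion_slope_zero_ne_zero hb0 hb1 β₀ ξ β α N))

theorem continuousAt_energyRemainder (β₀ : ℝ) (ξ β α : ℕ → ℝ) (N : ℕ) :
    ContinuousAt (fun z => (truncatedExpansion b β₀ ξ β α N z).energyRemainder) 0 := by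
  have hslope := truncatedExpansion_slope_zero_ne_zero hb0 hb1 β₀ ξ β α N
  have hsq := pow_ne_zero 2 hslope
  have hcube := pow_ne_zero 3 hslope
  simp only [Expansion.energyRemainder, Expansion.height, Expansion.place, Expansion.place₁,
    Expansion.slope₁, Expansion.slope, truncatedExpansion, expansion, id] at hslope hsq hcube ⊢
  fun_prop (disch := assumption)

namespace IsFormalSolution

variable (h : IsFormalSolution b β₀ ξ β α) (T : ℝ) (N : ℕ)
include h

theorem limA_isBigO :
    (fun t => (truncatedExpansion b β₀ ξ β α N (t + T)⁻¹).limA)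
      =O[atTop] fun t => (t ^ (N + 1))⁻¹ := by
  obtain ⟨q, hq⟩ := exists_eval_truncatedExpansion_eq (E := Expansion.residualA)
    Expansion.map_residualA h.residualA_eq_zero N
  refine EventuallyEq.trans_isBigO ?_ (isBigO_inv_add_pow_mul T (N + 1)
    (continuousAt_div_slope_pow hb0 hb1 β₀ ξ β α N 3 (q.continuous.div_const 6)))
  filter_upwards [eventually_inv_add_ne_zero_and_slope_ne_zero hb0 hb1 β₀ ξ β α T N]
    with t ⟨hz, hslope⟩
  rw [Expansion.limA_eq_residualA hb0.ne' rfl rfl hz hslope, hq]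
  change (t + T)⁻¹ * _ / _ = _
  ring

theorem limB_isBigO :
    (fun t => (truncatedExpansion b β₀ ξ β α N (t + T)⁻¹).limB)
      =O[atTop] fun t => (t ^ (N + 2))⁻¹ := by
  obtain ⟨q, hq⟩ := exists_eval_truncatedExpansion_eq (E := Expansion.residualB)
    Expansion.map_residualB h.residualB_eq_zero N
  refine EventuallyEq.trans_isBigO ?_ (isBigO_inv_add_pow_mul T (N + 2)
    (continuousAt_div_slope_pow hb0 hb1 β₀ ξ β α N 4 (q.continuous.div_const 12)))
  filter_upwards [eventually_inv_add_ne_zero_and_slope_ne_zero hb0 hb1 β₀ ξ β α T N]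
    with t ⟨_, hslope⟩
  rw [Expansion.limB_eq_residualB hb0.ne' rfl rfl hslope, hq]
  change (t + T)⁻¹ ^ 2 * _ / _ = _
  ring

omit hb1 in
theorem limX_isBigO :
    (fun t => (truncatedExpansion b β₀ ξ β α N (t + T)⁻¹).limX)
      =O[atTop] fun t => (t ^ (N + 2))⁻¹ := by
  obtain ⟨q, hq⟩ := exists_eval_truncatedExpansion_eq (E := Expansion.residualX)
    Expansion.map_residualX h.residualX_eq_zero N
  have hcont : Continuous fun z => (truncatedExpansion b β₀ ξ β α N z).height * q.eval z / 3 :=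
    ((continuous_truncatedExpansion_height b β₀ ξ β α N).mul q.continuous).div_const 3
  refine (isBigO_inv_add_pow_mul T (N + 2) hcont.continuousAt).congr_left fun t => ?_
  rw [Expansion.limX_eq_residualX hb0.ne' rfl, hq]
  change _ = (t + T)⁻¹ ^ 2 * _ * _ / 3
  ring

theorem limB_sub_isBigO :
    (fun t => let e := truncatedExpansion b β₀ ξ β α N (t + T)⁻¹
      e.limB - e.place / e.z / (e.slope / e.z) * e.limX)
      =O[atTop] fun t => (t ^ (N + 1))⁻¹ := by
  have hratio := isBigO_comp_inv_add T (continuousAt_div_slope_pow hb0 hb1 β₀ ξ β α N 1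
    (continuous_truncatedExpansion_place b β₀ ξ β α N))
  have hprod : (fun t => let e := truncatedExpansion b β₀ ξ β α N (t + T)⁻¹
      e.place / e.z / (e.slope / e.z) * e.limX) =O[atTop] fun t => (t ^ (N + 2))⁻¹ := by
    refine EventuallyEq.trans_isBigO ?_
      ((hratio.mul (h.limX_isBigO hb0 T N)).congr_right fun _ => one_mul _)
    filter_upwards [eventually_inv_add_ne_zero_and_slope_ne_zero hb0 hb1 β₀ ξ β α T N]
      with t ⟨hz, _⟩
    simp only [div_div_div_cancel_right₀ hz, pow_one]
  exact ((h.limB_isBigO hb0 hb1 T N).sub hprod).trans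
    (isBigO_inv_pow_of_le N.succ.le_succ)

theorem limX_div_isBigO :
    (fun t => let e := truncatedExpansion b β₀ ξ β α N (t + T)⁻¹
      e.limX / (e.slope / e.z)) =O[atTop] fun t => (t ^ (N + 1))⁻¹ := by
  have hinv := isBigO_comp_inv_add T (continuousAt_div_slope_pow hb0 hb1 β₀ ξ β α N 1 continuous_id)
  refine (((h.limX_isBigO hb0 T N).mul hinv).congr ?_ fun _ => mul_one _).trans
    (isBigO_inv_pow_of_le N.succ.le_succ)
  intro t
  rw [div_div_eq_mul_div, pow_one, mul_div_assoc]
  rfl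

end IsFormalSolution

end Truncation

/-! ### Conservation of energy -/

theorem hasDerivAt_limEnergy (b : ℝ) {A A₁ B B₁ X X₁ : ℝ → ℝ} {A₂ B₂ X₂ t : ℝ}
    (hA : IsJet A A₁ A₂ t) (hB : IsJet B B₁ B₂ t) (hX : IsJet X X₁ X₂ t) (hB0 : B t ≠ 0) :
    HasDerivAt (fun t => limEnergy b (A t) (A₁ t) (B t) (B₁ t) (X t) (X₁ t))
      (A₁ t * limA b (A t) (A₁ t) A₂ (B t) (B₁ t) B₂ (X t) (X₁ t) X₂
        + B₁ t * limB b (A t) (A₁ t) A₂ (B t) (B₁ t) B₂ (X₁ t)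
        + X₁ t * limX b (A t) (A₁ t) A₂ (B t) (B₁ t) (X₁ t) X₂) t := by
  have hheight := (hA.2.fun_pow 2).fun_mul ((hX.hasDerivAt.const_mul 2).fun_sub
    ((hasDerivAt_const t (1 : ℝ)).fun_div hB.hasDerivAt hB0))
  have hslope := (((hA.hasDerivAt.fun_pow 2).const_mul ((Real.pi ^ 2 / 9 - 2 / 3) / 2)).fun_mul
    (hB.2.fun_pow 2)).fun_div (hB.hasDerivAt.fun_pow 3) (pow_ne_zero 3 hB0)
  have hplace := (((hA.hasDerivAt.fun_pow 2).const_mul (2 / 3)).fun_mul hB.hasDerivAt).fun_mul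
    (hX.2.fun_pow 2)
  have hheightSlope := ((hA.hasDerivAt.fun_mul hA.2).fun_mul hB.2).fun_div
    (hB.hasDerivAt.fun_pow 2) (pow_ne_zero 2 hB0)
  have hheightPlace := ((hA.hasDerivAt.const_mul 2).fun_mul hA.2).fun_mul hX.2
  have hgradient := ((hA.hasDerivAt.fun_pow 2).fun_mul hB.hasDerivAt).div_const 3
  have hbulk := (hX.hasDerivAt.const_mul 2).fun_mul
    ((((hA.hasDerivAt.fun_pow 4).const_mul 2).fun_sub
      ((hA.hasDerivAt.fun_pow 3).const_mul (4 / 3 * (2 / b + b)))).fun_add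
        ((hA.hasDerivAt.fun_pow 2).const_mul 2))
  have hwall := ((((hA.hasDerivAt.fun_pow 4).const_mul (11 / 3)).fun_sub
    ((hA.hasDerivAt.fun_pow 3).const_mul (4 / b + 2 * b))).fun_add
    ((hA.hasDerivAt.fun_pow 2).const_mul 2)).fun_div hB.hasDerivAt hB0
  have hkinetic := (((hheight.fun_add hslope).fun_add hplace).fun_add hheightSlope).fun_add
    hheightPlace
  refine ((((hkinetic.const_mul (1 / 2)).fun_add hgradient).fun_add hbulk).fun_sub
    hwall).congr_deriv ?_
  simp only [limA, limB, limX, div_eq_mul_inv _ b]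
  generalize b⁻¹ = r
  field_simp
  ring

theorem abs_sub_le_of_abs_deriv_le {f f' : ℝ → ℝ} {c t s : ℝ} {n : ℕ} (ht : 0 < t) (hts : t ≤ s)
    (hf : ∀ u, t ≤ u → HasDerivAt f (f' u) u)
    (hbound : ∀ u, t ≤ u → |f' u| ≤ c * (n + 1) * (u ^ (n + 2))⁻¹) :
    |f s - f t| ≤ c * ((t ^ (n + 1))⁻¹ - (s ^ (n + 1))⁻¹) := by
  have hderiv (u : ℝ) (hu : t ≤ u) : HasDerivAt (fun u => c * ((t ^ (n + 1))⁻¹ - (u ^ (n + 1))⁻¹))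
      (c * (n + 1) * (u ^ (n + 2))⁻¹) u := by
    have hu0 : u ≠ 0 := (ht.trans_le hu).ne'
    refine ((((hasDerivAt_pow (n + 1) u).fun_inv (pow_ne_zero _ hu0)).const_sub _).const_mul
      c).congr_deriv ?_
    push_cast
    field_simp
    ring
  have hsub (u : ℝ) (hu : t ≤ u) : HasDerivAt (fun u => f u - f t) (f' u) u :=
    (hf u hu).sub_const (f t)
  refine image_norm_le_of_norm_deriv_right_le_deriv_boundary' (f := fun u => f u - f t)
    (fun u hu => (hsub u hu.1).continuousAt.continuousWithinAt)
    (fun u hu => (hsub u hu.1).hasDerivWithinAt) ?_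
    (fun u hu => (hderiv u hu.1).continuousAt.continuousWithinAt)
    (fun u hu => (hderiv u hu.1).hasDerivWithinAt) (fun u hu => hbound u hu.1) ⟨hts, le_rfl⟩
  simp only [sub_self, norm_zero, mul_zero, le_refl]

theorem isBigO_sub_of_deriv {f f' : ℝ → ℝ} {e : ℝ} {n : ℕ}
    (hf : ∀ᶠ t in atTop, HasDerivAt f (f' t) t) (hlim : Tendsto f atTop (nhds e))
    (hf' : f' =O[atTop] fun t : ℝ => (t ^ (n + 2))⁻¹) :
    (fun t => f t - e) =O[atTop] fun t : ℝ => (t ^ (n + 1))⁻¹ := by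
  obtain ⟨c, -, hc⟩ := hf'.exists_nonneg
  obtain ⟨t₀, ht₀⟩ := eventually_atTop.1 (hf.and hc.bound)
  refine IsBigO.of_bound (c / (n + 1)) ?_
  filter_upwards [eventually_ge_atTop t₀, eventually_gt_atTop 0] with t ht hpos
  have hbound (u : ℝ) (hu : t ≤ u) : |f' u| ≤ c / (n + 1) * (n + 1) * (u ^ (n + 2))⁻¹ := by
    rw [div_mul_cancel₀ _ n.cast_add_one_ne_zero,
      ← abs_of_pos (inv_pos.2 (pow_pos (hpos.trans_le hu) (n + 2)))]
    exact (ht₀ u (ht.trans hu)).2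
  have hinv : Tendsto (fun s : ℝ => (s ^ (n + 1))⁻¹) atTop (nhds 0) :=
    tendsto_inv_atTop_zero.comp (tendsto_pow_atTop n.succ_ne_zero)
  have hle : |e - f t| ≤ c / (n + 1) * ((t ^ (n + 1))⁻¹ - 0) := by
    refine le_of_tendsto_of_tendsto (hlim.sub_const (f t)).abs
      ((hinv.const_sub _).const_mul (c / (n + 1))) ?_
    filter_upwards [eventually_ge_atTop t] with s hs
    exact abs_sub_le_of_abs_deriv_le hpos hs (fun u hu => (ht₀ u (ht.trans hu)).1) hbound
  rwa [sub_zero, abs_sub_comm, ← abs_of_pos (inv_pos.2 (pow_pos hpos (n + 1)))] at hle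

section Truncation

variable {b β₀ : ℝ} {ξ β α : ℕ → ℝ} (hb0 : 0 < b) (hb1 : b < 1)
include hb0 hb1

theorem tendsto_limEnergy_truncatedExpansion (β₀ : ℝ) (ξ β α : ℕ → ℝ) (T : ℝ) (N : ℕ) :
    Tendsto (fun t => (truncatedExpansion b β₀ ξ β α N (t + T)⁻¹).limEnergy) atTop
      (nhds (2 / 3 * β₀ / b ^ 2)) := by
  have hcont : ContinuousAt (fun z => 2 / 3 * β₀ / b ^ 2
      + z * (truncatedExpansion b β₀ ξ β α N z).energyRemainder) 0 :=
    continuousAt_const.add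
      (continuousAt_id.mul (continuousAt_energyRemainder hb0 hb1 β₀ ξ β α N))
  have hlim := hcont.tendsto.comp (tendsto_inv_add T)
  rw [zero_mul, add_zero] at hlim
  refine hlim.congr' ?_
  filter_upwards [eventually_inv_add_ne_zero_and_slope_ne_zero hb0 hb1 β₀ ξ β α T N]
    with t ⟨hz, hslope⟩
  exact (Expansion.limEnergy_eq_add_energyRemainder hb0.ne' rfl rfl hz hslope).symm

theorem hasDerivAt_limEnergy_truncatedExpansion (β₀ : ℝ) (ξ β α : ℕ → ℝ) (T : ℝ) (N : ℕ) :
    ∀ᶠ t in atTop, let e t := truncatedExpansion b β₀ ξ β α N (t + T)⁻¹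
      HasDerivAt (fun t => (e t).limEnergy)
        ((e t).height₁ * (e t).limA + (e t).slope₁ * (e t).limB + (e t).place₁ * (e t).limX) t := by
  have w := wideCurve_series hb0 β₀ ξ β α T N hb1
  filter_upwards [w.jetA.jet, w.jetB.jet, w.jetX.jet, w.pos, eventually_add_ne_zero T]
    with t hA hB hX hpos ht
  have hcont : ContinuousAt (fun s => s + T) t := by fun_prop
  obtain ⟨hAt, hBt, hXt⟩ := series_eq_truncatedExpansion hb0 β₀ ξ β α T N ht
  refine ((hasDerivAt_limEnergy b hA hB hX hpos.1.ne').congr_deriv ?_).congr_of_eventuallyEq ?_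
  · rw [hAt, hBt, hXt]
    rfl
  · filter_upwards [hcont.eventually_ne ht] with s hs
    obtain ⟨hAs, hBs, hXs⟩ := series_eq_truncatedExpansion hb0 β₀ ξ β α T N hs
    rw [hAs, hBs, hXs]
    rfl

namespace IsFormalSolution

variable (h : IsFormalSolution b β₀ ξ β α) (T : ℝ) (N : ℕ)
include h

theorem limEnergy_isBigO :
    (fun t => (truncatedExpansion b β₀ ξ β α N (t + T)⁻¹).limEnergy - 2 / 3 * β₀ / b ^ 2)
      =O[atTop] fun t => (t ^ (N + 1))⁻¹ := by
  refine isBigO_sub_of_deriv (hasDerivAt_limEnergy_truncatedExpansion hb0 hb1 β₀ ξ β α T N)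
    (tendsto_limEnergy_truncatedExpansion hb0 hb1 β₀ ξ β α T N) ?_
  have hheight : (fun t => (truncatedExpansion b β₀ ξ β α N (t + T)⁻¹).height₁)
      =O[atTop] fun t => (t ^ 1)⁻¹ := by
    have hcont : Continuous fun z => -(z ^ 2 * partialSum N (weighted 2 α) z) := by fun_prop
    refine (isBigO_inv_add_pow_mul T 1 hcont.continuousAt).congr_left fun t => ?_
    simp only [Expansion.height₁, truncatedExpansion, expansion]
    ring
  have hslope : (fun t => (truncatedExpansion b β₀ ξ β α N (t + T)⁻¹).slope₁)
      =O[atTop] fun _ => (1 : ℝ) := by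
    refine isBigO_comp_inv_add T (Continuous.continuousAt ?_)
      (φ := fun z => (truncatedExpansion b β₀ ξ β α N z).slope₁)
    simp only [Expansion.slope₁, truncatedExpansion, expansion, id]
    fun_prop
  have hplace : (fun t => (truncatedExpansion b β₀ ξ β α N (t + T)⁻¹).place₁)
      =O[atTop] fun _ => (1 : ℝ) := by
    refine isBigO_comp_inv_add T (Continuous.continuousAt ?_)
      (φ := fun z => (truncatedExpansion b β₀ ξ β α N z).place₁)
    simp only [Expansion.place₁, truncatedExpansion, expansion]
    fun_prop
  refine (((hheight.mul (h.limA_isBigO hb0 hb1 T N)).congr_right fun t => ?_).add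
    ((hslope.mul (h.limB_isBigO hb0 hb1 T N)).congr_right fun t => one_mul _)).add
    ((hplace.mul (h.limX_isBigO hb0 T N)).congr_right fun t => one_mul _)
  rw [← mul_inv, ← pow_add, add_comm 1]

variable {a : ℝ} (ha : 0 < a) (hab : Real.tanh (2 * a) = 3 * b / (2 + b ^ 2))
include ha hab

theorem isSeriesSolution :
    IsSeriesSolution a (seriesA b T fun n => α (n - 2)) (seriesB b T β₀ fun n => β (n - 1))
      (seriesX T fun n => ξ (n - 1)) := by
  intro N
  have w := wideCurve_series hb0 β₀ ξ β α T N hb1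
  refine ⟨w.variationA_isBigO ha hb0 hab (EventuallyEq.trans_isBigO ?_
      (h.limA_isBigO hb0 hb1 T N)),
    w.variationB_isBigO ha hb0 hab (EventuallyEq.trans_isBigO ?_
      (h.limB_sub_isBigO hb0 hb1 T N)),
    w.variationC_isBigO ha hb0 hab (EventuallyEq.trans_isBigO ?_
      (h.limX_div_isBigO hb0 hb1 T N))⟩
  all_goals
    filter_upwards [eventually_add_ne_zero T] with t ht
    obtain ⟨hA, hB, hX⟩ := series_eq_truncatedExpansion hb0 β₀ ξ β α T N ht
    simp only [hA, hB, hX]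
    rfl

theorem fieldEnergy_isBigO :
    (fun t => fieldEnergy a (lump (seriesA b T (fun n => α (n - 2)) (N + 1))
        (seriesB b T β₀ (fun n => β (n - 1)) N) (seriesX T (fun n => ξ (n - 1)) N)) t
      - 2 / 3 * β₀ / b ^ 2) =O[atTop] fun t => (t ^ (N + 1))⁻¹ := by
  refine (wideCurve_series hb0 β₀ ξ β α T N hb1).energy_isBigO ha hb0 hab
    (EventuallyEq.trans_isBigO ?_ (h.limEnergy_isBigO hb0 hb1 T N))
  filter_upwards [eventually_add_ne_zero T] with t ht
  obtain ⟨hA, hB, hX⟩ := series_eq_truncatedExpansion hb0 β₀ ξ β α T N ht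
  simp only [hA, hB, hX]
  rfl

end IsFormalSolution

end Truncation

end Sphaleron

end

theorem theorem1 (a b : ℝ) (ha : 0 < a) (hb0 : 0 < b) (hb1 : b < 1)
    (hab : Real.tanh (2 * a) = 3 * b / (2 + b ^ 2)) (B₀ : ℝ) :
    ∃ ξ β α : ℕ → ℝ,
      -- the explicit coefficients of `X`
      ξ 1 = b ^ 2 / (8 * (1 - b ^ 2) ^ 2) ∧
      ξ 2 = b ^ 2 / (8 * (1 - b ^ 2) ^ 2) * (-(b ^ 2 * B₀ / (2 * (1 - b ^ 2)))) ∧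
      ξ 3 = b ^ 2 / (8 * (1 - b ^ 2) ^ 2) *
        (b ^ 4 * B₀ ^ 2 / (4 * (1 - b ^ 2) ^ 2) + Real.pi ^ 2 * b ^ 2 / 12
          + b ^ 2 * (12 * b ^ 6 - 44 * b ^ 4 + 53 * b ^ 2 - 22)
            / (16 * (2 - b ^ 2) * (1 - b ^ 2) ^ 2)) ∧
      -- the explicit coefficients of `B`
      β 1 = b ^ 2 / (4 * (1 - b ^ 2)) * ((3 - 2 * b ^ 2) / (2 - b ^ 2)) ∧
      β 2 = b ^ 2 / (4 * (1 - b ^ 2)) * (-(B₀ / (2 * (1 - b ^ 2)))) ∧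
      β 3 = b ^ 2 / (4 * (1 - b ^ 2)) *
        (b ^ 2 * B₀ ^ 2 / (4 * (1 - b ^ 2) ^ 2)
          + Real.pi ^ 2 * (22 - 13 * b ^ 2) / (36 * (2 - b ^ 2))
          + (80 * b ^ 10 - 686 * b ^ 8 + 2213 * b ^ 6 - 3368 * b ^ 4 + 2450 * b ^ 2 - 692)
            / (48 * (1 - b ^ 2) ^ 2 * (2 - b ^ 2) ^ 3)) ∧
      -- the explicit coefficients of `A`
      α 2 = b / (8 * (2 - b ^ 2)) ∧
      α 3 = b / (8 * (2 - b ^ 2)) * (-(b ^ 2 * B₀ / (2 * (1 - b ^ 2)))) ∧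
      α 4 = b / (8 * (2 - b ^ 2)) *
        (b ^ 4 * B₀ ^ 2 / (4 * (1 - b ^ 2) ^ 2) - Real.pi ^ 2 * b ^ 2 / (18 * (1 - b ^ 2))
          - b ^ 2 * (17 * b ^ 6 - 91 * b ^ 4 + 148 * b ^ 2 - 62)
            / (24 * (1 - b ^ 2) ^ 2 * (2 - b ^ 2) ^ 2)) ∧
      ∀ T : ℝ,
        -- the series solve the Euler-Lagrange equations to all orders
        Sphaleron.IsSeriesSolution a (Sphaleron.seriesA b T α) (Sphaleron.seriesB b T B₀ β)
          (Sphaleron.seriesX T ξ) ∧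
        -- the energy of the lump is `(2 / 3) B₀ / b²` to all orders
        ∀ N : ℕ,
          (fun t : ℝ => Sphaleron.fieldEnergy a
              (Sphaleron.lump (Sphaleron.seriesA b T α (N + 1)) (Sphaleron.seriesB b T B₀ β N)
                (Sphaleron.seriesX T ξ N)) t
            - 2 / 3 * B₀ / b ^ 2)
            =O[atTop] fun t : ℝ => (t ^ (N + 1))⁻¹ := by
  obtain ⟨ξ, β, α, h⟩ := Sphaleron.exists_isFormalSolution hb0 hb1 B₀
  obtain ⟨hξ₁, hβ₁, hα₂⟩ := h.coeff_zero_eq hb0 hb1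
  obtain ⟨hξ₂, hβ₂, hα₃⟩ := h.coeff_one_eq hb0 hb1
  refine ⟨fun n => ξ (n - 1), fun n => β (n - 1), fun n => α (n - 2),
    hξ₁, hξ₂, h.coeff_two_x_eq hb0 hb1, hβ₁, hβ₂, h.coeff_two_y_eq hb0 hb1,
    hα₂, hα₃, h.coeff_two_a_eq hb0 hb1, fun T => ⟨?_, fun N => ?_⟩⟩
  · exact h.isSeriesSolution hb0 hb1 T ha hab
  · exact h.fieldEnergy_isBigO hb0 hb1 T N ha hab
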